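/- Let $R$ be a commutative Noetherian ring, let $\mathfrak b\subseteq\mathfrak a$ be ideals of $R$, let $M$ be a finitely generated $R$-module, and let $r\ge 1$ be an integer. For $i\ge 0$ let $H^i_{\mathfrak a}(M)=\varinjlim_{n}\operatorname{Ext}^i_R(R/\mathfrak a^n,M)$ denote the $i$-th local cohomology module. An $R$-module $L$ is called minimax if it has a finitely generated submodule $N$ such that $L/N$ is Artinian. It is called $\mathfrak a$-cofinite if $\operatorname{Supp} L\subseteq V(\mathfrak a)$ and $\operatorname{Ext}^j_R(R/\mathfrak a,L)$ is finitely generated for all $j\ge 0$. The $\mathfrak b$-minimaxness dimension of $M$ relative to $\mathfrak a$ is $$\mu^{\mathfrak b}_{\mathfrak a}(M)=\inf\{\,i\ge 1 : \mathfrak b^tH^i_{\mathfrak a}(M)\text{ is not minimax for every integer } t\ge 1\,\},$$ where the infimum of the empty set is $\infty$. For a prime ideal $\mathfrak p$ of $R$, $\mu^{\mathfrak bR_{\mathfrak p}}_{\mathfrak aR_{\mathfrak p}}(M_{\mathfrak p})$ is defined in the same way over the ring $R_{\mathfrak p}$. Suppose that $H^0_{\mathfrak a}(M),\dots,H^{r-1}_{\mathfrak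 a}(M)$ are $\mathfrak a$-cofinite. Then $$\mu^{\mathfrak bR_{\mathfrak p}}_{\mathfrak aR_{\mathfrak p}}(M_{\mathfrak p})>r\ \text{ for all } \mathfrak p\in\operatorname{Spec} R\iff \mu^{\mathfrak b}_{\mathfrak a}(M)>r.$$ -/

import Mathlib

open CategoryTheory

universe u

/-- `L` is minimax: it has a finitely generated submodule with Artinian quotient. -/
def IsMinimax (R : Type u) [CommRing R] (L : Type u) [AddCommGroup L] [Module R L] : Prop :=
  ∃ N : Submodule R L, N.FG ∧ IsArtinian R (L ⧸ N)

/-- `L` is `a`-cofinite: `Supp L ⊆ V(a)` and `Ext^j_R(R/a, L)` is finitely generated for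
every `j ≥ 0`. -/
def IsCofiniteModule {R : Type u} [CommRing R] (a : Ideal R)
    (L : Type u) [AddCommGroup L] [Module R L] : Prop :=
  Module.support R L ⊆ PrimeSpectrum.zeroLocus (a : Set R) ∧
    ∀ j : ℕ, Module.Finite R (Abelian.Ext (ModuleCat.of R (R ⧸ a)) (ModuleCat.of R L) j)

/-- The `i`-th local cohomology module `H^i_a(M) = colim_n Ext^i_R(R/a^n, M)`. -/
noncomputable abbrev LocalCoh {R : Type u} [CommRing R] (a : Ideal R) (i : ℕ)
    (M : Type u) [AddCommGroup M] [Module R M] : ModuleCat.{u} R :=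
  (localCohomology a i).obj (ModuleCat.of R M)

/-- The `b`-minimaxness dimension `μ^b_a(M)` of `M` relative to `a`: the infimum of the
positive integers `i` such that `b^t H^i_a(M)` is not minimax for every positive integer `t`;
it is `⊤` (that is, `∞`) if there is no such `i`. -/
noncomputable def minimaxnessDimension {R : Type u} [CommRing R] (b a : Ideal R)
    (M : Type u) [AddCommGroup M] [Module R M] : ℕ∞ :=
  sInf {n : ℕ∞ | ∃ i : ℕ, n = (i : ℕ∞) ∧ 1 ≤ i ∧ ∀ t : ℕ, 1 ≤ t →
    ¬ IsMinimax R (b ^ t • (⊤ : Submodule R (LocalCoh a i M)) : Submodule R (LocalCoh a i M))}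

/-!
The minimaxness dimension exceeds `r` if and only if for each `1 ≤ i ≤ r` some `b ^ t H^i_a(M)` is
minimax. Local cohomology modules are `a`-torsion, and `b ≤ a`, so a power of `b` kills the finitely
generated part of a minimax submodule. Hence some `b ^ t H^i_a(M)` being minimax is the same as some
`b ^ t H^i_a(M)` being Artinian (`exists_isMinimax_pow_smul_iff`), over `R` and over each `R_p`.

Local cohomology commutes with localization (`localCohomology.nonempty_localizationEquiv`), and
localization preserves Artinian modules, which settles the passage from `R` to `R_p`.

For the converse let `L = H^i_a(M)` with `1 ≤ i ≤ r`. Cofiniteness of `H^0_a(M), …, H^{r-1}_a(M)`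
makes `Hom(R/a, L)`, that is `(0 :_L a)`, finitely generated, also for `i = r`
(`extFinite_zero_localCohomology`). So `L` has finitely many associated primes. If `p` is a
nonmaximal one and `m` is a maximal ideal containing it, then an Artinian `b ^ t L_m` contains no
element with annihilator `p R_m` (`eq_of_isArtinian_localization`). A large `t` therefore leaves
only maximal ideals among the associated primes of `b ^ t L`. The finitely generated module
`(0 :_{b ^ t L} a)` is then Artinian, and so is `b ^ t L`, by Melkersson's criterion
(`IsPowerTorsion.isArtinian`).

Both facts about local cohomology are proved by dimension shifting along `0 → M → I → Q → 0` with
`I` injective. This needs only `H^0_a = Γ_a` (`localCohomology.zeroEquiv`) and the exactness of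
`H^n_a(I) → H^n_a(Q) → H^{n+1}_a(M) → 0` (`localCohomology.exists_connecting`), which comes from the
long exact sequence of `Ext` in its second variable. As Mathlib defines local cohomology by deriving
`Hom(-, M)` in its first variable, that sequence is first built from projective resolutions. The
finiteness statements use `Abelian.Ext` instead; the two never have to be compared.
-/

/-! ### The long exact sequence of `Ext` in the second variable, for derived functors of `Hom` -/

namespace localCohomology

open Limits Opposite

section Ext

variable {R : Type u} [CommRing R]

/-- The contravariant functor `Hom(-, Y)`, regarded as a covariant functor into the opposite
category. Mathlib defines the functors `Ext^n(-, Y)` behind `localCohomology` as the left derived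
functors of this one, so cohomological sequences appear below with their arrows reversed. -/
noncomputable abbrev homOp (Y : ModuleCat.{u} R) : ModuleCat.{u} R ⥤ (ModuleCat.{u} R)ᵒᵖ :=
  ((linearYoneda R (ModuleCat.{u} R)).obj Y).rightOp

/-- The natural transformation `Hom(-, Y) ⟶ Hom(-, Z)` induced by `f : Y ⟶ Z`, which points from
`homOp Z` to `homOp Y` because the target category is opposite. -/
noncomputable abbrev homOpMap {Y Z : ModuleCat.{u} R} (f : Y ⟶ Z) : homOp Z ⟶ homOp Y :=
  NatTrans.rightOp ((linearYoneda R (ModuleCat.{u} R)).map f)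

variable (S : ShortComplex (ModuleCat.{u} R))

/-- The sequence `Hom(X, S.X₁) → Hom(X, S.X₂) → Hom(X, S.X₃)`. -/
noncomputable def homSequence (X : ModuleCat.{u} R) : ShortComplex (ModuleCat.{u} R) :=
  S.map ((linearCoyoneda R (ModuleCat.{u} R)).obj (op X))

lemma homSequence_shortExact {S : ShortComplex (ModuleCat.{u} R)} (hS : S.ShortExact)
    (X : ModuleCat.{u} R) [Projective X] : (homSequence S X).ShortExact := by
  have := hS.mono_f
  have := hS.epi_g
  refine ModuleCat.shortComplex_shortExact _ ?_ ?_ ?_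
  · intro (f : X ⟶ S.X₂)
    constructor
    · intro (hf : f ≫ S.g = 0)
      exact ⟨hS.exact.lift f hf, hS.exact.lift_f f hf⟩
    · rintro ⟨k : X ⟶ S.X₁, rfl⟩
      change (k ≫ S.f) ≫ S.g = 0
      simp
  · intro (f : X ⟶ S.X₁) (g : X ⟶ S.X₁) (h : f ≫ S.f = g ≫ S.f)
    exact (cancel_mono _).1 h
  · intro (f : X ⟶ S.X₃)
    exact ⟨Projective.factorThru f S.g, Projective.factorThru_comp f S.g⟩

/-- The sequence of complexes `Hom(P, S)`, in the opposite category, where it runs from `S.X₃` to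
`S.X₁`. -/
noncomputable def homComplexes (P : ChainComplex (ModuleCat.{u} R) ℕ) :
    ShortComplex (ChainComplex (ModuleCat.{u} R)ᵒᵖ ℕ) :=
  ShortComplex.mk
    ((NatTrans.mapHomologicalComplex (homOpMap S.g) (ComplexShape.down ℕ)).app P)
    ((NatTrans.mapHomologicalComplex (homOpMap S.f) (ComplexShape.down ℕ)).app P) (by
      ext n
      exact (homSequence S (P.X n)).op.zero)

variable {S}

lemma homComplexes_shortExact (hS : S.ShortExact) (P : ChainComplex (ModuleCat.{u} R) ℕ)
    [∀ n, Projective (P.X n)] : (homComplexes S P).ShortExact :=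
  HomologicalComplex.shortExact_of_degreewise_shortExact _ fun n =>
    (homSequence_shortExact hS (P.X n)).op

/-- The morphism between the sequences `Hom(P, S)` and `Hom(P', S)` induced by a map of complexes
`P ⟶ P'`. -/
noncomputable def homComplexesMap {P P' : ChainComplex (ModuleCat.{u} R) ℕ} (φ : P ⟶ P') :
    homComplexes S P ⟶ homComplexes S P' where
  τ₁ := ((homOp S.X₃).mapHomologicalComplex _).map φ
  τ₂ := ((homOp S.X₂).mapHomologicalComplex _).map φ
  τ₃ := ((homOp S.X₁).mapHomologicalComplex _).map φ
  comm₁₂ := (NatTrans.mapHomologicalComplex (homOpMap S.g) (ComplexShape.down ℕ)).naturality φ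
  comm₂₃ := (NatTrans.mapHomologicalComplex (homOpMap S.f) (ComplexShape.down ℕ)).naturality φ

/-- The cohomology in degree `n` of the complex `Hom(P, Y)`, as an object of the opposite
category. -/
noncomputable abbrev homHomology (Y : ModuleCat.{u} R) (P : ChainComplex (ModuleCat.{u} R) ℕ)
    (n : ℕ) : (ModuleCat.{u} R)ᵒᵖ :=
  (HomologicalComplex.homologyFunctor _ (ComplexShape.down ℕ) n).obj
    (((homOp Y).mapHomologicalComplex _).obj P)

/-- Functoriality of `homHomology Y P n` in the complex `P`. -/
noncomputable abbrev homHomologyMapLeft (Y : ModuleCat.{u} R)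
    {P P' : ChainComplex (ModuleCat.{u} R) ℕ} (φ : P ⟶ P')
    (n : ℕ) : homHomology Y P n ⟶ homHomology Y P' n :=
  (HomologicalComplex.homologyFunctor _ (ComplexShape.down ℕ) n).map
    (((homOp Y).mapHomologicalComplex _).map φ)

/-- Functoriality of `homHomology Y P n` in the module `Y`. -/
noncomputable abbrev homHomologyMapRight {Y Z : ModuleCat.{u} R} (f : Y ⟶ Z)
    (P : ChainComplex (ModuleCat.{u} R) ℕ)
    (n : ℕ) : homHomology Z P n ⟶ homHomology Y P n :=
  (HomologicalComplex.homologyFunctor _ (ComplexShape.down ℕ) n).map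
    ((NatTrans.mapHomologicalComplex (homOpMap f) (ComplexShape.down ℕ)).app P)

/-- The connecting morphism of the long exact sequence of `Hom(P, S)` for a complex `P` of
projectives. In the category of modules it is the usual map
`Hⁿ(Hom(P, S.X₃)) → Hⁿ⁺¹(Hom(P, S.X₁))`. -/
noncomputable def homHomologyδ (hS : S.ShortExact) (P : ChainComplex (ModuleCat.{u} R) ℕ)
    [∀ n, Projective (P.X n)] (n : ℕ) : homHomology S.X₁ P (n + 1) ⟶ homHomology S.X₃ P n :=
  (homComplexes_shortExact hS P).δ (n + 1) n (by simp)

lemma homHomologyδ_naturality (hS : S.ShortExact) {P P' : ChainComplex (ModuleCat.{u} R) ℕ}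
    [∀ n, Projective (P.X n)] [∀ n, Projective (P'.X n)] (φ : P ⟶ P') (n : ℕ) :
    homHomologyδ hS P n ≫ homHomologyMapLeft S.X₃ φ n =
      homHomologyMapLeft S.X₁ φ (n + 1) ≫ homHomologyδ hS P' n :=
  HomologicalComplex.HomologySequence.δ_naturality (homComplexesMap (S := S) φ)
      (homComplexes_shortExact hS P) (homComplexes_shortExact hS P') (n+1) n (by simp)

lemma homHomologyδ_comp (hS : S.ShortExact) (P : ChainComplex (ModuleCat.{u} R) ℕ)
    [∀ n, Projective (P.X n)] (n : ℕ) :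
    homHomologyδ hS P n ≫ homHomologyMapRight S.g P n = 0 :=
  (homComplexes_shortExact hS P).δ_comp (n + 1) n (by simp)

lemma homHomologyδ_exact (hS : S.ShortExact) (P : ChainComplex (ModuleCat.{u} R) ℕ)
    [∀ n, Projective (P.X n)] (n : ℕ) :
    (ShortComplex.mk _ _ (homHomologyδ_comp hS P n)).Exact :=
  (homComplexes_shortExact hS P).homology_exact₁ (n + 1) n (by simp)

/-- The connecting morphism `Extⁿ(-, S.X₃) ⟶ Extⁿ⁺¹(-, S.X₁)`, natural in the first variable; it is
read in the opposite category, hence its direction. Naturality makes it pass to the direct limit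
defining local cohomology. -/
noncomputable def extδ (hS : S.ShortExact) (n : ℕ) :
    (homOp S.X₁).leftDerived (n + 1) ⟶ (homOp S.X₃).leftDerived n where
  app X := ((projectiveResolution X).isoLeftDerivedObj (homOp S.X₁) (n + 1)).hom ≫
    homHomologyδ hS (projectiveResolution X).complex n ≫
    ((projectiveResolution X).isoLeftDerivedObj (homOp S.X₃) n).inv
  naturality X Y f := by
    let P := projectiveResolution X
    let P' := projectiveResolution Y
    let φ := ProjectiveResolution.lift f P P'
    have comm : φ.f 0 ≫ P'.π.f 0 = P.π.f 0 ≫ f := ProjectiveResolution.lift_commutes_zero f P P'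
    have h1 : ((homOp S.X₁).leftDerived (n + 1)).map f ≫
        (P'.isoLeftDerivedObj (homOp S.X₁) (n + 1)).hom =
      (P.isoLeftDerivedObj (homOp S.X₁) (n + 1)).hom ≫ homHomologyMapLeft S.X₁ φ (n + 1) :=
      ProjectiveResolution.isoLeftDerivedObj_hom_naturality f P P' φ comm (homOp S.X₁) (n+1)
    have h2 : (P.isoLeftDerivedObj (homOp S.X₃) n).inv ≫ ((homOp S.X₃).leftDerived n).map f =
      homHomologyMapLeft S.X₃ φ n ≫ (P'.isoLeftDerivedObj (homOp S.X₃) n).inv :=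
      ProjectiveResolution.isoLeftDerivedObj_inv_naturality f P P' φ comm (homOp S.X₃) n
    have h3 := homHomologyδ_naturality hS φ n
    calc _ = (((homOp S.X₁).leftDerived (n + 1)).map f ≫
        (P'.isoLeftDerivedObj (homOp S.X₁) (n + 1)).hom) ≫ homHomologyδ hS P'.complex n ≫
          (P'.isoLeftDerivedObj (homOp S.X₃) n).inv := (Category.assoc _ _ _).symm
      _ = (P.isoLeftDerivedObj (homOp S.X₁) (n + 1)).hom ≫
          (homHomologyMapLeft S.X₁ φ (n + 1) ≫ homHomologyδ hS P'.complex n) ≫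
          (P'.isoLeftDerivedObj (homOp S.X₃) n).inv := by
        rw [h1]; simp only [Category.assoc]
      _ = (P.isoLeftDerivedObj (homOp S.X₁) (n + 1)).hom ≫ homHomologyδ hS P.complex n ≫
          (P.isoLeftDerivedObj (homOp S.X₃) n).inv ≫ ((homOp S.X₃).leftDerived n).map f := by
        rw [← h3, h2]; simp only [Category.assoc]
      _ = _ := by simp only [Category.assoc]; rfl

lemma extδ_comp (hS : S.ShortExact) (n : ℕ) (X : ModuleCat.{u} R) :
    (extδ hS n).app X ≫ (NatTrans.leftDerived (homOpMap S.g) n).app X = 0 := by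
  let P := projectiveResolution X
  calc _ = ((P.isoLeftDerivedObj (homOp S.X₁) (n + 1)).hom ≫ homHomologyδ hS P.complex n ≫
          (P.isoLeftDerivedObj (homOp S.X₃) n).inv) ≫
          (P.isoLeftDerivedObj (homOp S.X₃) n).hom ≫ homHomologyMapRight S.g P.complex n ≫
            (P.isoLeftDerivedObj (homOp S.X₂) n).inv := by
        rw [P.leftDerived_app_eq]; rfl
    _ = (P.isoLeftDerivedObj (homOp S.X₁) (n + 1)).hom ≫
          (homHomologyδ hS P.complex n ≫ homHomologyMapRight S.g P.complex n) ≫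
            (P.isoLeftDerivedObj (homOp S.X₂) n).inv := by
        simp only [Category.assoc, Iso.inv_hom_id_assoc]
    _ = 0 := by rw [homHomologyδ_comp, zero_comp, comp_zero]

lemma extδ_exact (hS : S.ShortExact) (n : ℕ) (X : ModuleCat.{u} R) :
    (ShortComplex.mk _ _ (extδ_comp hS n X)).Exact := by
  let P := projectiveResolution X
  refine (ShortComplex.exact_iff_of_iso (ShortComplex.isoMk
    (P.isoLeftDerivedObj (homOp S.X₁) (n + 1)) (P.isoLeftDerivedObj (homOp S.X₃) n)
    (P.isoLeftDerivedObj (homOp S.X₂) n) ?_ ?_)).2 (homHomologyδ_exact hS P.complex n)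
  · change _ ≫ homHomologyδ hS P.complex n = ((P.isoLeftDerivedObj (homOp S.X₁) (n + 1)).hom ≫
      homHomologyδ hS P.complex n ≫ (P.isoLeftDerivedObj (homOp S.X₃) n).inv) ≫ _
    simp only [Category.assoc, Iso.inv_hom_id, Category.comp_id]
  · change _ ≫ homHomologyMapRight S.g P.complex n = _ ≫ _
    dsimp only
    rw [P.leftDerived_app_eq]
    simp only [Category.assoc, Iso.inv_hom_id, Category.comp_id]

/-- `Extⁿ⁺¹(X, I) = 0` for `I` injective, with `Ext` computed from a projective resolution. -/
lemma isZero_leftDerived_homOp_succ (I : ModuleCat.{u} R) [Injective I] (n : ℕ)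
    (X : ModuleCat.{u} R) : IsZero (((homOp I).leftDerived (n + 1)).obj X) := by
  let P := projectiveResolution X
  refine IsZero.of_iso ?_ (P.isoLeftDerivedObj (homOp I) (n + 1))
  -- `Hom(-, I)` is exact, so it preserves the exactness of `P` in degree `n + 1`
  refine (HomologicalComplex.exactAt_iff_isZero_homology _ _).1 ?_
  rw [HomologicalComplex.exactAt_iff' _ (n + 2) (n + 1) n (by simp) (by simp)]
  rw [← ShortComplex.exact_unop_iff, ShortComplex.moduleCat_exact_iff]
  intro (f : P.complex.X (n + 1) ⟶ I) (hf : P.complex.d (n + 2) (n + 1) ≫ f = 0)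
  have h := P.complex_exactAt_succ n
  rw [HomologicalComplex.exactAt_iff' _ (n + 2) (n + 1) n (by simp) (by simp)] at h
  exact ⟨h.descToInjective f hf, h.comp_descToInjective f hf⟩

/-- Read in the category of modules: `Extⁿ(X, S.X₃) → Extⁿ⁺¹(X, S.X₁)` is onto if `S.X₂` is
injective. -/
lemma extδ_mono (hS : S.ShortExact) [Injective S.X₂] (n : ℕ) (X : ModuleCat.{u} R) :
    Mono ((extδ hS n).app X) := by
  let P := projectiveResolution X
  have hz : IsZero ((homComplexes S P.complex).X₂.homology (n + 1)) :=
    (isZero_leftDerived_homOp_succ S.X₂ n X).of_iso (P.isoLeftDerivedObj (homOp S.X₂) (n + 1)).symm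
  have : Mono (homHomologyδ hS P.complex n) :=
    (homComplexes_shortExact hS P.complex).mono_δ (n + 1) n (by simp) hz
  change Mono (((projectiveResolution X).isoLeftDerivedObj (homOp S.X₁) (n + 1)).hom ≫
    homHomologyδ hS (projectiveResolution X).complex n ≫
    ((projectiveResolution X).isoLeftDerivedObj (homOp S.X₃) n).inv)
  infer_instance

lemma fromLeftDerivedZero'_naturality_right {X Y Z : ModuleCat.{u} R} (f : Y ⟶ Z)
    (P : ProjectiveResolution X) :
    HomologicalComplex.opcyclesMap ((NatTrans.mapHomologicalComplex (homOpMap f)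
      (ComplexShape.down ℕ)).app P.complex) 0 ≫ P.fromLeftDerivedZero' (homOp Y) =
    P.fromLeftDerivedZero' (homOp Z) ≫ (homOpMap f).app X := by
  rw [← cancel_epi (HomologicalComplex.pOpcycles _ _)]
  rw [HomologicalComplex.p_opcyclesMap_assoc,
    ProjectiveResolution.pOpcycles_comp_fromLeftDerivedZero',
    ProjectiveResolution.pOpcycles_comp_fromLeftDerivedZero'_assoc]
  exact ((homOpMap f).naturality (P.π.f 0)).symm

lemma fromLeftDerivedZero_naturality {Y Z : ModuleCat.{u} R} (f : Y ⟶ Z) :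
   NatTrans.leftDerived (homOpMap f) 0 ≫ (homOp Y).fromLeftDerivedZero =
     (homOp Z).fromLeftDerivedZero ≫ homOpMap f := by
  ext X : 2
  let P := projectiveResolution X
  have h : homHomologyMapRight f P.complex 0 ≫ HomologicalComplex.homologyι _ 0 =
      HomologicalComplex.homologyι _ 0 ≫ HomologicalComplex.opcyclesMap
        ((NatTrans.mapHomologicalComplex (homOpMap f) (ComplexShape.down ℕ)).app P.complex) 0 :=
    HomologicalComplex.homologyι_naturality _ _
  rw [NatTrans.comp_app, NatTrans.comp_app, P.leftDerived_app_eq, P.fromLeftDerivedZero_eq,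
    P.fromLeftDerivedZero_eq]
  simp only [Category.assoc, Iso.inv_hom_id_assoc]
  congr 1
  refine (Category.assoc (homHomologyMapRight f P.complex 0) (HomologicalComplex.homologyι _ 0)
    (P.fromLeftDerivedZero' (homOp Y))).symm.trans ?_
  rw [h]
  refine (Category.assoc _ _ _).trans ?_
  rw [fromLeftDerivedZero'_naturality_right]
  exact (Category.assoc _ _ _).symm

/-- Left exactness of `Hom(-, Y)`. It makes `Hom(-, Y) ⟶ Ext⁰(-, Y)` an isomorphism. -/
instance (Y : ModuleCat.{u} R) : PreservesFiniteColimits (homOp Y) := by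
  have : PreservesLimits ((linearYoneda R (ModuleCat.{u} R)).obj Y ⋙ forget _) :=
    inferInstanceAs (PreservesLimits (yoneda.obj Y))
  have : PreservesLimits ((linearYoneda R (ModuleCat.{u} R)).obj Y) :=
    preservesLimits_of_reflects_of_preserves _ (forget (ModuleCat.{u} R))
  exact preservesFiniteColimits_rightOp _

end Ext

/-! ### The long exact sequence of local cohomology, and degree zero -/

section Colimit

variable {R : Type u} [CommRing R] (a : Ideal R)

/-- The direct system `t ↦ Extⁿ(R/aᵗ, Y)`, whose colimit is `Hⁿ_a(Y)`. The doubly opposite index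
category is the one of Mathlib's definition of local cohomology. -/
noncomputable abbrev idealPowersExt (n : ℕ) (Y : ModuleCat.{u} R) :
    ℕᵒᵖᵒᵖ ⥤ ModuleCat.{u} R :=
  (ringModIdeals (idealPowersDiagram a)).op ⋙ ((homOp Y).leftDerived n).leftOp

/-- The maps `Extⁿ(R/aᵗ, Y) ⟶ Hⁿ_a(Y)`. -/
noncomputable def extCocone (n : ℕ) (Y : ModuleCat.{u} R) : Cocone (idealPowersExt a n Y) where
  pt := (localCohomology a n).obj Y
  ι := { app t := (colimit.ι (diagram (idealPowersDiagram a) n) t).app Y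
         naturality s t f := by
          have := congr_arg (fun α => α.app Y) (colimit.w (diagram (idealPowersDiagram a) n) f)
          exact this.trans (Category.comp_id _).symm }

/-- Colimits of functors are computed pointwise, so `Hⁿ_a(Y)` is the direct limit of the modules
`Extⁿ(R/aᵗ, Y)`. -/
noncomputable def extCoconeIsColimit (n : ℕ) (Y : ModuleCat.{u} R) :
    IsColimit (extCocone a n Y) :=
  isColimitOfPreserves ((evaluation _ _).obj Y)
    (colimit.isColimit (diagram (idealPowersDiagram a) n))

lemma extCocone_naturality (n : ℕ) {Y Z : ModuleCat.{u} R} (f : Y ⟶ Z) (t : ℕᵒᵖᵒᵖ) :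
    (extCocone a n Y).ι.app t ≫ (localCohomology a n).map f =
      (((NatTrans.leftDerived (homOpMap f) n).app
        ((ringModIdeals (idealPowersDiagram a)).obj t.unop)).unop :
          (idealPowersExt a n Y).obj t ⟶ (idealPowersExt a n Z).obj t) ≫
        (extCocone a n Z).ι.app t :=
  ((colimit.ι (diagram (idealPowersDiagram a) n) t).naturality f).symm

/-- The connecting morphisms `Extⁿ(R/aᵗ, S.X₃) ⟶ Extⁿ⁺¹(R/aᵗ, S.X₁)`, as a map of direct
systems. -/
noncomputable def connectingTrans {S : ShortComplex (ModuleCat.{u} R)} (hS : S.ShortExact)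
    (n : ℕ) : idealPowersExt a n S.X₃ ⟶ idealPowersExt a (n + 1) S.X₁ :=
  Functor.whiskerLeft (ringModIdeals (idealPowersDiagram a)).op (NatTrans.leftOp (extδ hS n))

/-- The connecting morphism `Hⁿ_a(S.X₃) ⟶ Hⁿ⁺¹_a(S.X₁)`. -/
noncomputable def connecting {S : ShortComplex (ModuleCat.{u} R)} (hS : S.ShortExact) (n : ℕ) :
    (localCohomology a n).obj S.X₃ ⟶ (localCohomology a (n + 1)).obj S.X₁ :=
  (extCoconeIsColimit a n S.X₃).map (extCocone a (n + 1) S.X₁) (connectingTrans a hS n)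

lemma ι_connecting {S : ShortComplex (ModuleCat.{u} R)} (hS : S.ShortExact) (n : ℕ)
    (t : ℕᵒᵖᵒᵖ) :
    (extCocone a n S.X₃).ι.app t ≫ connecting a hS n =
      (connectingTrans a hS n).app t ≫ (extCocone a (n + 1) S.X₁).ι.app t :=
  (extCoconeIsColimit a n S.X₃).ι_map _ _ t

-- The index category `ℕᵒᵖᵒᵖ` lives in universe `0`, which instance search does not reconcile with
-- the universe `u` of the modules.
instance (F : ℕᵒᵖᵒᵖ ⥤ ModuleCat.{u} R) : PreservesColimit F (forget (ModuleCat.{u} R)) := by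
  have : PreservesFilteredColimitsOfSize.{0, 0} (forget (ModuleCat.{u} R)) :=
    preservesFilteredColimitsOfSize_shrink.{0, u, 0, u} (forget (ModuleCat.{u} R))
  infer_instance

variable {a} in
lemma eq_zero_of_ι_eq_zero {n : ℕ} {Y : ModuleCat.{u} R} {t : ℕᵒᵖᵒᵖ}
    (x : (idealPowersExt a n Y).obj t) (hx : (extCocone a n Y).ι.app t x = 0) :
    ∃ (s : ℕᵒᵖᵒᵖ) (f : t ⟶ s), (idealPowersExt a n Y).map f x = 0 := by
  obtain ⟨s, f, g, h⟩ := Concrete.isColimit_exists_of_rep_eq _ (extCoconeIsColimit a n Y) x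
    (0 : (idealPowersExt a n Y).obj t) (by rw [hx, map_zero])
  exact ⟨s, f, by rw [h, map_zero]⟩

lemma connecting_surjective {S : ShortComplex (ModuleCat.{u} R)} (hS : S.ShortExact)
    [Injective S.X₂] (n : ℕ) : Function.Surjective (connecting a hS n) := by
  intro y
  obtain ⟨t, y, rfl⟩ := Concrete.isColimit_exists_rep _ (extCoconeIsColimit a (n + 1) S.X₁) y
  have := extδ_mono hS n ((ringModIdeals (idealPowersDiagram a)).obj t.unop)
  have : Epi ((connectingTrans a hS n).app t) :=
    unop_epi_of_mono ((extδ hS n).app ((ringModIdeals (idealPowersDiagram a)).obj t.unop))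
  obtain ⟨x, rfl⟩ := (ModuleCat.epi_iff_surjective _).1 this y
  refine ⟨(extCocone a n S.X₃).ι.app t x, ?_⟩
  exact ConcreteCategory.congr_hom (ι_connecting a hS n t) x

lemma connecting_exact {S : ShortComplex (ModuleCat.{u} R)} (hS : S.ShortExact) (n : ℕ) :
    Function.Exact ((localCohomology a n).map S.g) (connecting a hS n) := by
  have key (t : ℕᵒᵖᵒᵖ) := (ShortComplex.ShortExact.moduleCat_exact_iff_function_exact _).1
    (extδ_exact hS n ((ringModIdeals (idealPowersDiagram a)).obj t.unop)).unop
  intro x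
  constructor
  · intro hx
    obtain ⟨t, x, rfl⟩ := Concrete.isColimit_exists_rep _ (extCoconeIsColimit a n S.X₃) x
    have h1 : (extCocone a (n + 1) S.X₁).ι.app t ((connectingTrans a hS n).app t x) = 0 :=
      (ConcreteCategory.congr_hom (ι_connecting a hS n t) x).symm.trans hx
    obtain ⟨s, f, h2⟩ := eq_zero_of_ι_eq_zero _ h1
    have h3 : (connectingTrans a hS n).app s ((idealPowersExt a n S.X₃).map f x) = 0 :=
      (ConcreteCategory.congr_hom ((connectingTrans a hS n).naturality f) x).trans h2
    obtain ⟨z, hz⟩ := (key s _).1 h3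
    refine ⟨(extCocone a n S.X₂).ι.app s z, ?_⟩
    refine (ConcreteCategory.congr_hom (extCocone_naturality a n S.g s) z).trans ?_
    refine (congr_arg ((extCocone a n S.X₃).ι.app s) hz).trans ?_
    exact ConcreteCategory.congr_hom ((extCocone a n S.X₃).w f) x
  · rintro ⟨z, rfl⟩
    obtain ⟨t, z, rfl⟩ := Concrete.isColimit_exists_rep _ (extCoconeIsColimit a n S.X₂) z
    have h1 := ConcreteCategory.congr_hom (extCocone_naturality a n S.g t) z
    refine (congr_arg (connecting a hS n) h1).trans ?_
    refine (ConcreteCategory.congr_hom (ι_connecting a hS n t) _).trans ?_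
    refine (congr_arg ((extCocone a (n + 1) S.X₁).ι.app t) ((key t _).2 ⟨z, rfl⟩)).trans ?_
    exact map_zero _

lemma subsingleton_of_injective (I : ModuleCat.{u} R) [Injective I] (n : ℕ) :
    Subsingleton ((localCohomology a (n + 1)).obj I) := by
  refine subsingleton_of_forall_eq 0 fun y => ?_
  obtain ⟨t, y, rfl⟩ := Concrete.isColimit_exists_rep _ (extCoconeIsColimit a (n + 1) I) y
  have : Subsingleton ((idealPowersExt a (n + 1) I).obj t) :=
    ModuleCat.subsingleton_of_isZero (isZero_leftDerived_homOp_succ I n _).unop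
  rw [Subsingleton.elim y 0]
  exact map_zero _

/-- Evaluation at `1`, a map `Hom(R/aᵗ, Y) ⟶ Y`. It identifies `Hom(R/aᵗ, Y)` with the submodule
of elements of `Y` killed by `aᵗ`. -/
noncomputable def evalOne (t : ℕᵒᵖᵒᵖ) (Y : ModuleCat.{u} R) :
    ((homOp Y).obj ((ringModIdeals (idealPowersDiagram a)).obj t.unop)).unop ⟶ Y :=
  ModuleCat.ofHom
    { toFun := fun f => f.hom (Ideal.Quotient.mk (a ^ t.unop.unop) 1)
      map_add' := fun _ _ => rfl
      map_smul' := fun _ _ => rfl }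

/-- The composite `Ext⁰(R/aᵗ, Y) ≅ Hom(R/aᵗ, Y) ⟶ Y` of the canonical isomorphism and
evaluation at `1`. -/
noncomputable def extZeroEval (t : ℕᵒᵖᵒᵖ) (Y : ModuleCat.{u} R) :
    (idealPowersExt a 0 Y).obj t ⟶ Y :=
  (inv ((homOp Y).fromLeftDerivedZero.app
    ((ringModIdeals (idealPowersDiagram a)).obj t.unop))).unop ≫ evalOne a t Y

lemma extZeroEval_naturality (t : ℕᵒᵖᵒᵖ) {Y Z : ModuleCat.{u} R} (f : Y ⟶ Z) :
    (((NatTrans.leftDerived (homOpMap f) 0).app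
        ((ringModIdeals (idealPowersDiagram a)).obj t.unop)).unop :
          (idealPowersExt a 0 Y).obj t ⟶ (idealPowersExt a 0 Z).obj t) ≫ extZeroEval a t Z =
      extZeroEval a t Y ≫ f := by
  let X := (ringModIdeals (idealPowersDiagram a)).obj t.unop
  have h1 : (NatTrans.leftDerived (homOpMap f) 0).app X ≫ (homOp Y).fromLeftDerivedZero.app X =
      (homOp Z).fromLeftDerivedZero.app X ≫ (homOpMap f).app X :=
    congr_arg (fun α => NatTrans.app α X) (fromLeftDerivedZero_naturality f)
  have h2 : inv ((homOp Z).fromLeftDerivedZero.app X) ≫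
      (NatTrans.leftDerived (homOpMap f) 0).app X =
      (homOpMap f).app X ≫ inv ((homOp Y).fromLeftDerivedZero.app X) := by
    rw [IsIso.inv_comp_eq, ← Category.assoc, ← h1, Category.assoc, IsIso.hom_inv_id,
      Category.comp_id]
  have h3 := congr_arg Quiver.Hom.unop h2
  rw [unop_comp, unop_comp] at h3
  change ((NatTrans.leftDerived (homOpMap f) 0).app X).unop ≫
    (inv ((homOp Z).fromLeftDerivedZero.app X)).unop ≫ evalOne a t Z = _
  rw [← Category.assoc, h3]
  rfl

lemma extZeroEval_w {s t : ℕᵒᵖᵒᵖ} (f : s ⟶ t) (Y : ModuleCat.{u} R) :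
    (idealPowersExt a 0 Y).map f ≫ extZeroEval a t Y = extZeroEval a s Y := by
  have h1 := (homOp Y).fromLeftDerivedZero.naturality
    ((ringModIdeals (idealPowersDiagram a)).map f.unop)
  have h2 : inv ((homOp Y).fromLeftDerivedZero.app
      ((ringModIdeals (idealPowersDiagram a)).obj t.unop)) ≫
      ((homOp Y).leftDerived 0).map ((ringModIdeals (idealPowersDiagram a)).map f.unop) =
      (homOp Y).map ((ringModIdeals (idealPowersDiagram a)).map f.unop) ≫
      inv ((homOp Y).fromLeftDerivedZero.app
        ((ringModIdeals (idealPowersDiagram a)).obj s.unop)) := by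
    rw [IsIso.inv_comp_eq, ← Category.assoc, ← h1, Category.assoc, IsIso.hom_inv_id,
      Category.comp_id]
  have h3 := congr_arg Quiver.Hom.unop h2
  rw [unop_comp, unop_comp] at h3
  change (((homOp Y).leftDerived 0).map
    ((ringModIdeals (idealPowersDiagram a)).map f.unop)).unop ≫
    (inv ((homOp Y).fromLeftDerivedZero.app _)).unop ≫ evalOne a t Y = _
  rw [← Category.assoc, h3]
  rfl

/-- The maps `Ext⁰(R/aᵗ, Y) ⟶ Y`, as a cocone of functors in `Y`. -/
noncomputable def zeroEvalCocone : Cocone (diagram (idealPowersDiagram a) 0) where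
  pt := 𝟭 (ModuleCat.{u} R)
  ι :=
    { app t := { app Y := extZeroEval a t Y
                 naturality Y Z f := extZeroEval_naturality a t f }
      naturality s t f := by
        ext Y : 2
        exact (extZeroEval_w a f Y).trans (Category.comp_id _).symm }

/-- The natural map `H⁰_a(Y) ⟶ Y`; it is injective, with image the `a`-torsion submodule. -/
noncomputable def zeroEval : localCohomology a 0 ⟶ 𝟭 (ModuleCat.{u} R) :=
  colimit.desc (diagram (idealPowersDiagram a) 0) (zeroEvalCocone a)

lemma ι_zeroEval (t : ℕᵒᵖᵒᵖ) (Y : ModuleCat.{u} R) :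
    (extCocone a 0 Y).ι.app t ≫ (zeroEval a).app Y = extZeroEval a t Y :=
  congr_arg (fun α => NatTrans.app α Y) (colimit.ι_desc (zeroEvalCocone a) t)

lemma evalOne_injective (t : ℕᵒᵖᵒᵖ) (Y : ModuleCat.{u} R) :
    Function.Injective (evalOne a t Y) := by
  intro f g h
  refine ModuleCat.hom_ext (Submodule.linearMap_qext _ (LinearMap.ext_ring ?_))
  exact h

lemma extZeroEval_injective (t : ℕᵒᵖᵒᵖ) (Y : ModuleCat.{u} R) :
    Function.Injective (extZeroEval a t Y) := by
  refine (evalOne_injective a t Y).comp ?_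
  exact (ModuleCat.mono_iff_injective _).1 inferInstance

lemma mem_range_extZeroEval_iff (t : ℕᵒᵖᵒᵖ) (Y : ModuleCat.{u} R) (y : Y) :
    y ∈ Set.range (extZeroEval a t Y) ↔ ∀ r ∈ a ^ t.unop.unop, r • y = 0 := by
  constructor
  · rintro ⟨x, rfl⟩ r hr
    let f := (inv ((homOp Y).fromLeftDerivedZero.app
      ((ringModIdeals (idealPowersDiagram a)).obj t.unop))).unop x
    change r • f.hom (Ideal.Quotient.mk (a ^ t.unop.unop) 1) = 0
    have h : f.hom (Ideal.Quotient.mk (a ^ t.unop.unop) r) = 0 := by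
      rw [Ideal.Quotient.eq_zero_iff_mem.2 hr]
      exact map_zero _
    refine ((map_smul f.hom r (Ideal.Quotient.mk (a ^ t.unop.unop) 1)).symm.trans ?_).trans h
    refine congr_arg f.hom ?_
    change Ideal.Quotient.mk (a ^ t.unop.unop) (r * 1) = _
    rw [mul_one]
  · intro h
    let f : (ringModIdeals (idealPowersDiagram a)).obj t.unop ⟶ Y :=
      ModuleCat.ofHom (Submodule.liftQ (a ^ t.unop.unop) (LinearMap.toSpanSingleton R Y y) h)
    refine ⟨((homOp Y).fromLeftDerivedZero.app
      ((ringModIdeals (idealPowersDiagram a)).obj t.unop)).unop f, ?_⟩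
    have h1 := congr_arg Quiver.Hom.unop (IsIso.inv_hom_id ((homOp Y).fromLeftDerivedZero.app
      ((ringModIdeals (idealPowersDiagram a)).obj t.unop)))
    have h2 := ConcreteCategory.congr_hom h1 f
    refine (congr_arg (evalOne a t Y) h2).trans ?_
    exact one_smul R y

lemma zeroEval_injective (Y : ModuleCat.{u} R) : Function.Injective ((zeroEval a).app Y) := by
  refine (injective_iff_map_eq_zero _).2 fun x hx => ?_
  obtain ⟨t, x, rfl⟩ := Concrete.isColimit_exists_rep _ (extCoconeIsColimit a 0 Y) x
  have h1 : extZeroEval a t Y x = 0 :=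
    (ConcreteCategory.congr_hom (ι_zeroEval a t Y) x).symm.trans hx
  have h2 : x = 0 := extZeroEval_injective a t Y (h1.trans (map_zero _).symm)
  rw [h2]
  exact map_zero _

lemma mem_range_zeroEval_iff (Y : ModuleCat.{u} R) (y : Y) :
    y ∈ Set.range ((zeroEval a).app Y) ↔ ∃ t : ℕ, ∀ r ∈ a ^ t, r • y = 0 := by
  constructor
  · rintro ⟨x, rfl⟩
    obtain ⟨t, x, rfl⟩ := Concrete.isColimit_exists_rep _ (extCoconeIsColimit a 0 Y) x
    refine ⟨t.unop.unop, (mem_range_extZeroEval_iff a t Y _).1 ⟨x, ?_⟩⟩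
    exact (ConcreteCategory.congr_hom (ι_zeroEval a t Y) x).symm
  · rintro ⟨t, ht⟩
    obtain ⟨x, hx⟩ := (mem_range_extZeroEval_iff a (op (op t)) Y y).2 ht
    exact ⟨(extCocone a 0 Y).ι.app _ x,
      (ConcreteCategory.congr_hom (ι_zeroEval a (op (op t)) Y) x).trans hx⟩

end Colimit

end localCohomology

/-! ### Torsion modules and dimension shifting -/

section Unbundled

variable {R : Type u} [CommRing R] (a : Ideal R)

/-- `L` is `a`-torsion: every element of `L` is annihilated by a power of `a`. In other words, the
`a`-torsion submodule `Γ_a(L)`, which is `a.primaryComponent L` in Mathlib, is all of `L`. -/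
def IsPowerTorsion (a : Ideal R) (L : Type*) [AddCommGroup L] [Module R L] : Prop :=
  ∀ x : L, ∃ n : ℕ, ∀ r ∈ a ^ n, r • x = 0

variable {a}

lemma mem_primaryComponent_iff {M : Type*} [AddCommGroup M] [Module R M] {x : M} :
    x ∈ a.primaryComponent M ↔ ∃ n : ℕ, ∀ r ∈ a ^ n, r • x = 0 := by
  rw [Ideal.primaryComponent_mem]
  simp only [Submodule.mem_torsionBySet_iff, Subtype.forall, SetLike.mem_coe]

variable {L L' : Type*} [AddCommGroup L] [Module R L] [AddCommGroup L'] [Module R L']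

lemma isPowerTorsion_primaryComponent : IsPowerTorsion a (a.primaryComponent L) := by
  rintro ⟨x, hx⟩
  obtain ⟨n, hn⟩ := mem_primaryComponent_iff.1 hx
  exact ⟨n, fun r hr => Subtype.ext (hn r hr)⟩

lemma IsPowerTorsion.of_surjective (h : IsPowerTorsion a L) (f : L →ₗ[R] L')
    (hf : Function.Surjective f) : IsPowerTorsion a L' := by
  intro y
  obtain ⟨x, rfl⟩ := hf y
  obtain ⟨n, hn⟩ := h x
  exact ⟨n, fun r hr => by rw [← map_smul, hn r hr, map_zero]⟩

lemma IsPowerTorsion.of_injective (h : IsPowerTorsion a L') (f : L →ₗ[R] L')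
    (hf : Function.Injective f) : IsPowerTorsion a L := by
  intro x
  obtain ⟨n, hn⟩ := h (f x)
  exact ⟨n, fun r hr => hf (by rw [map_smul, hn r hr, map_zero])⟩

variable (R) in
lemma exists_injective_embedding (M : Type u) [AddCommGroup M] [Module R M] :
    ∃ (I : Type u) (_ : AddCommGroup I) (_ : Module R I) (f : M →ₗ[R] I),
      Module.Injective R I ∧ Function.Injective f := by
  let J := Injective.under (ModuleCat.of R M)
  refine ⟨J, inferInstance, inferInstance, (Injective.ι (ModuleCat.of R M)).hom, ?_,
    (ModuleCat.mono_iff_injective _).1 inferInstance⟩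
  have : Injective (ModuleCat.of R J) := inferInstanceAs (Injective J)
  exact (Module.injective_iff_injective_object R J).2 this

end Unbundled

namespace localCohomology

variable {R : Type u} [CommRing R] (a : Ideal R)

section Zero

variable (M : Type u) [AddCommGroup M] [Module R M]

/-- The isomorphism `H⁰_a(M) ≅ Γ_a(M)`. -/
noncomputable def zeroEquiv : LocalCoh a 0 M ≃ₗ[R] a.primaryComponent M :=
  LinearEquiv.ofBijective
    (LinearMap.codRestrict (a.primaryComponent M) ((zeroEval a).app (ModuleCat.of R M)).hom
      fun x => mem_primaryComponent_iff.2
        ((mem_range_zeroEval_iff a (ModuleCat.of R M) _).1 ⟨x, rfl⟩))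
    ⟨fun _ _ h => zeroEval_injective a (ModuleCat.of R M) (congr_arg Subtype.val h), fun y => by
      obtain ⟨x, hx⟩ := (mem_range_zeroEval_iff a (ModuleCat.of R M) y.1).2
        (mem_primaryComponent_iff.1 y.2)
      exact ⟨x, Subtype.ext hx⟩⟩

lemma zeroEquiv_naturality {M N : Type u} [AddCommGroup M] [Module R M] [AddCommGroup N]
    [Module R N] (f : M →ₗ[R] N) (x : LocalCoh a 0 M) :
    zeroEquiv a N ((localCohomology a 0).map (ModuleCat.ofHom f) x) =
      Ideal.primaryComponent.map a f (zeroEquiv a M x) :=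
  Subtype.ext (ConcreteCategory.congr_hom ((zeroEval a).naturality (ModuleCat.ofHom f)) x)

end Zero

section DimensionShift

variable {M I Q : Type u} [AddCommGroup M] [Module R M] [AddCommGroup I] [Module R I]
  [AddCommGroup Q] [Module R Q] {f : M →ₗ[R] I} {g : I →ₗ[R] Q}

variable (I) in
lemma subsingleton_succ [Module.Injective R I] (n : ℕ) : Subsingleton (LocalCoh a (n + 1) I) := by
  have : Injective (ModuleCat.of R I) := Module.injective_object_of_injective_module R I
  exact subsingleton_of_injective a (ModuleCat.of R I) n

/-- The part of the long exact sequence of `0 → M → I → Q → 0` used for dimension shifting: if `I`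
is injective, `Hⁿ⁺¹_a(M)` is the cokernel of `Hⁿ_a(I) → Hⁿ_a(Q)`. -/
lemma exists_connecting [Module.Injective R I] (hf : Function.Injective f)
    (hfg : Function.Exact f g) (hg : Function.Surjective g) (n : ℕ) :
    ∃ δ : LocalCoh a n Q →ₗ[R] LocalCoh a (n + 1) M, Function.Surjective δ ∧
      Function.Exact ((localCohomology a n).map (ModuleCat.ofHom g)) δ := by
  let S : ShortComplex (ModuleCat.{u} R) :=
    ShortComplex.mk (ModuleCat.ofHom f) (ModuleCat.ofHom g) (by
      ext x; exact hfg.apply_apply_eq_zero x)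
  have hS : S.ShortExact := ModuleCat.shortComplex_shortExact S hfg hf hg
  have : Injective S.X₂ := Module.injective_object_of_injective_module R I
  exact ⟨(connecting a hS n).hom, connecting_surjective a hS n, connecting_exact a hS n⟩

/-- `H¹_a(M)` is the cokernel of `Γ_a(I) → Γ_a(Q)`. -/
lemma exists_connecting_zero [Module.Injective R I] (hf : Function.Injective f)
    (hfg : Function.Exact f g) (hg : Function.Surjective g) :
    ∃ δ : a.primaryComponent Q →ₗ[R] LocalCoh a 1 M, Function.Surjective δ ∧
      Function.Exact (Ideal.primaryComponent.map a g) δ := by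
  obtain ⟨δ, h1, h2⟩ := exists_connecting a hf hfg hg 0
  refine ⟨δ ∘ₗ (zeroEquiv a Q).symm.toLinearMap, h1.comp (zeroEquiv a Q).symm.surjective, ?_⟩
  intro x
  refine (h2 ((zeroEquiv a Q).symm x)).trans ?_
  constructor
  · rintro ⟨y, hy⟩
    refine ⟨zeroEquiv a I y, ?_⟩
    rw [← zeroEquiv_naturality, hy, LinearEquiv.apply_symm_apply]
  · rintro ⟨y, rfl⟩
    refine ⟨(zeroEquiv a I).symm y, (zeroEquiv a Q).injective ?_⟩
    rw [zeroEquiv_naturality, LinearEquiv.apply_symm_apply, LinearEquiv.apply_symm_apply]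

/-- Dimension shifting `Hⁿ⁺¹_a(Q) ≅ Hⁿ⁺²_a(M)` along `0 → M → I → Q → 0` with `I` injective. -/
lemma nonempty_shiftEquiv [Module.Injective R I] (hf : Function.Injective f)
    (hfg : Function.Exact f g) (hg : Function.Surjective g) (n : ℕ) :
    Nonempty (LocalCoh a (n + 1) Q ≃ₗ[R] LocalCoh a (n + 2) M) := by
  obtain ⟨δ, h1, h2⟩ := exists_connecting a hf hfg hg (n + 1)
  refine ⟨LinearEquiv.ofBijective δ ⟨(injective_iff_map_eq_zero _).2 fun x hx => ?_, h1⟩⟩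
  obtain ⟨y, rfl⟩ := (h2 x).1 hx
  have := subsingleton_succ a I n
  rw [Subsingleton.elim y 0]
  exact map_zero _

end DimensionShift

lemma isPowerTorsion (n : ℕ) (M : Type u) [AddCommGroup M] [Module R M] :
    IsPowerTorsion a (LocalCoh a n M) := by
  induction n generalizing M with
  | zero =>
    exact (isPowerTorsion_primaryComponent (a := a) (L := M)).of_injective
      (zeroEquiv a M).toLinearMap (zeroEquiv a M).injective
  | succ n ih =>
    obtain ⟨I, _, _, f, _, hf⟩ := exists_injective_embedding R M
    obtain ⟨δ, h, -⟩ := exists_connecting a hf (LinearMap.exact_map_mkQ_range f)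
      (Submodule.mkQ_surjective _) n
    exact (ih _).of_surjective δ h

end localCohomology

/-! ### Local cohomology commutes with localization -/

section Localization

variable {R : Type u} [CommRing R] (S : Submonoid R) (a : Ideal R)
variable (M : Type u) [AddCommGroup M] [Module R M]

lemma map_localization_smul_mk_eq_zero {M : Type*} [AddCommGroup M] [Module R M] {c : Ideal R}
    {m : M} (hm : ∀ r ∈ c, r • m = 0) (s : S) {z : Localization S}
    (hz : z ∈ c.map (algebraMap R (Localization S))) : z • LocalizedModule.mk m s = 0 := by
  have h : c.map (algebraMap R (Localization S)) ≤
      LinearMap.ker (LinearMap.toSpanSingleton (Localization S) _ (LocalizedModule.mk m s)) := by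
    refine Ideal.span_le.2 ?_
    rintro _ ⟨r, hr, rfl⟩
    change algebraMap R (Localization S) r • LocalizedModule.mk m s = 0
    rw [algebraMap_smul, LocalizedModule.smul'_mk, hm r hr, LocalizedModule.zero_mk]
  exact h hz

/-- If `m / s` is annihilated by the extension of a finitely generated ideal `c`, then some multiple
of `m` by an element of `S` is annihilated by `c`. -/
lemma exists_smul_mem_annihilates {M : Type*} [AddCommGroup M] [Module R M] {c : Ideal R}
    (hc : c.FG) {m : M} {s : S}
    (hm : ∀ z ∈ c.map (algebraMap R (Localization S)), z • LocalizedModule.mk m s = 0) :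
    ∃ v : S, ∀ r ∈ c, r • v • m = 0 := by
  obtain ⟨T, rfl⟩ := hc
  have h1 : ∀ r : T, ∃ v : S, v • (r : R) • m = 0 := by
    intro r
    have := hm _ (Ideal.mem_map_of_mem _ (Ideal.subset_span r.2))
    rw [algebraMap_smul, LocalizedModule.smul'_mk, ← LocalizedModule.zero_mk s,
      LocalizedModule.mk_eq] at this
    obtain ⟨u, hu⟩ := this
    refine ⟨u * s, ?_⟩
    rw [mul_smul, hu, smul_zero, smul_zero]
  choose v hv using h1
  refine ⟨∏ r, v r, fun r hr => ?_⟩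
  have h : Ideal.span (T : Set R) ≤
      LinearMap.ker (LinearMap.toSpanSingleton R M ((∏ r, v r) • m)) := by
    refine Ideal.span_le.2 fun r hr => ?_
    obtain ⟨w, hw⟩ := Finset.dvd_prod_of_mem v (Finset.mem_univ (⟨r, hr⟩ : T))
    change r • (∏ r, v r) • m = 0
    rw [hw, smul_comm, mul_comm, mul_smul, hv ⟨r, hr⟩, smul_zero]
  exact h hr

/-- The canonical map `S⁻¹ Γ_a(M) → Γ_{S⁻¹ a}(S⁻¹ M)`. -/
noncomputable def localizedPrimaryComponent :
    LocalizedModule S (a.primaryComponent M) →ₗ[Localization S]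
      (a.map (algebraMap R (Localization S))).primaryComponent (LocalizedModule S M) :=
  LinearMap.codRestrict _ (LocalizedModule.map S (a.primaryComponent M).subtype) fun x => by
    induction x using LocalizedModule.induction_on with
    | h x s =>
    obtain ⟨n, hn⟩ := mem_primaryComponent_iff.1 x.2
    rw [LocalizedModule.map_mk]
    refine mem_primaryComponent_iff.2 ⟨n, fun z hz => ?_⟩
    rw [← Ideal.map_pow] at hz
    exact map_localization_smul_mk_eq_zero S hn s hz

lemma localizedPrimaryComponent_bijective [IsNoetherianRing R] :
    Function.Bijective (localizedPrimaryComponent S a M) := by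
  constructor
  · intro x y h
    exact LocalizedModule.map_injective S _ (Submodule.subtype_injective _)
      (congr_arg Subtype.val h)
  · rintro ⟨y, hy⟩
    induction y using LocalizedModule.induction_on with
    | h m s =>
    obtain ⟨n, hn⟩ := mem_primaryComponent_iff.1 hy
    rw [← Ideal.map_pow] at hn
    obtain ⟨v, hv⟩ := exists_smul_mem_annihilates S (IsNoetherian.noetherian (a ^ n)) hn
    refine ⟨LocalizedModule.mk ⟨v • m, mem_primaryComponent_iff.2 ⟨n, hv⟩⟩ (v * s),
      Subtype.ext ?_⟩
    change LocalizedModule.map S _ _ = _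
    rw [LocalizedModule.map_mk]
    exact LocalizedModule.mk_cancel_common_left v s m

/-- The isomorphism `S⁻¹ Γ_a(M) ≅ Γ_{S⁻¹ a}(S⁻¹ M)`. -/
noncomputable def localizedPrimaryComponentEquiv [IsNoetherianRing R] :
    LocalizedModule S (a.primaryComponent M) ≃ₗ[Localization S]
      (a.map (algebraMap R (Localization S))).primaryComponent (LocalizedModule S M) :=
  LinearEquiv.ofBijective _ (localizedPrimaryComponent_bijective S a M)

lemma localizedPrimaryComponentEquiv_naturality [IsNoetherianRing R] {M N : Type u}
    [AddCommGroup M] [Module R M] [AddCommGroup N] [Module R N] (f : M →ₗ[R] N)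
    (x : LocalizedModule S (a.primaryComponent M)) :
    localizedPrimaryComponentEquiv S a N
        (LocalizedModule.map S (Ideal.primaryComponent.map a f) x) =
      Ideal.primaryComponent.map _ (LocalizedModule.map S f)
        (localizedPrimaryComponentEquiv S a M x) := by
  refine Subtype.ext ?_
  induction x using LocalizedModule.induction_on with
  | h x s =>
  change LocalizedModule.map S _ (LocalizedModule.map S _ _) =
    LocalizedModule.map S _ (LocalizedModule.map S _ _)
  simp only [LocalizedModule.map_mk]
  rfl

lemma LocalizedModule.exact_map {A B C : Type*} [AddCommGroup A] [Module R A] [AddCommGroup B]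
    [Module R B] [AddCommGroup C] [Module R C] {f : A →ₗ[R] B} {g : B →ₗ[R] C}
    (h : Function.Exact f g) :
    Function.Exact (LocalizedModule.map S f) (LocalizedModule.map S g) :=
  fun x => LocalizedModule.map_exact S f g h x

/-- The isomorphism of localizations induced by an isomorphism of modules. -/
noncomputable def LocalizedModule.congr {A B : Type*} [AddCommGroup A] [Module R A]
    [AddCommGroup B] [Module R B] (e : A ≃ₗ[R] B) :
    LocalizedModule S A ≃ₗ[Localization S] LocalizedModule S B :=
  LinearEquiv.ofBijective (LocalizedModule.map S e.toLinearMap)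
    ⟨LocalizedModule.map_injective S _ e.injective,
      LocalizedModule.map_surjective S _ e.surjective⟩

/-- Isomorphic presentations have isomorphic cokernels. -/
lemma nonempty_linearEquiv_of_exact {A B B' C C' A' : Type*} [AddCommGroup A] [Module R A]
    [AddCommGroup B] [Module R B] [AddCommGroup C] [Module R C] [AddCommGroup A'] [Module R A']
    [AddCommGroup B'] [Module R B'] [AddCommGroup C'] [Module R C'] {i : A →ₗ[R] B}
    {q : B →ₗ[R] C} {i' : A' →ₗ[R] B'} {q' : B' →ₗ[R] C'} (h : Function.Exact i q)
    (hq : Function.Surjective q) (h' : Function.Exact i' q') (hq' : Function.Surjective q')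
    (α : A ≃ₗ[R] A') (β : B ≃ₗ[R] B') (comm : ∀ x, β (i x) = i' (α x)) :
    Nonempty (C ≃ₗ[R] C') := by
  have e1 := (Submodule.quotEquivOfEq _ _ h.linearMap_ker_eq).symm.trans
    (q.quotKerEquivOfSurjective hq)
  have e2 := (Submodule.quotEquivOfEq _ _ h'.linearMap_ker_eq).symm.trans
    (q'.quotKerEquivOfSurjective hq')
  refine ⟨e1.symm.trans ((Submodule.Quotient.equiv _ _ β ?_).trans e2)⟩
  ext y
  constructor
  · rintro ⟨_, ⟨x, rfl⟩, rfl⟩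
    exact ⟨α x, (comm x).symm⟩
  · rintro ⟨x, rfl⟩
    exact ⟨_, ⟨α.symm x, rfl⟩, (comm _).trans (by rw [α.apply_symm_apply])⟩

/-- Local cohomology over a Noetherian ring commutes with localization. By dimension shifting this
reduces to the case of `Γ_a`, because localization is exact and, over a Noetherian ring, preserves
injective modules. -/
theorem localCohomology.nonempty_localizationEquiv [IsNoetherianRing R] (n : ℕ) :
    Nonempty (LocalizedModule S (LocalCoh a n M) ≃ₗ[Localization S]
      LocalCoh (a.map (algebraMap R (Localization S))) n (LocalizedModule S M)) := by
  induction n generalizing M with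
  | zero =>
    exact ⟨((LocalizedModule.congr S (zeroEquiv a M)).trans
      (localizedPrimaryComponentEquiv S a M)).trans (zeroEquiv _ _).symm⟩
  | succ n ih =>
    obtain ⟨I, _, _, f, _, hf⟩ := exists_injective_embedding R M
    have hfg := LinearMap.exact_map_mkQ_range f
    have hg := Submodule.mkQ_surjective (LinearMap.range f)
    have hI : Module.Injective (Localization S) (LocalizedModule S I) :=
      Module.injective_of_isLocalizedModule S (LocalizedModule.mkLinearMap S I)
    have hf' := LocalizedModule.map_injective S f hf
    have hg' := LocalizedModule.map_surjective S _ hg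
    have hfg' := LocalizedModule.exact_map S hfg
    -- in degree one the comparison is between cokernels, in higher degrees of shifted modules
    cases n with
    | zero =>
      obtain ⟨δ, h1, h2⟩ := exists_connecting_zero a hf hfg hg
      obtain ⟨δ', h1', h2'⟩ := exists_connecting_zero (a.map (algebraMap R (Localization S)))
        hf' hfg' hg'
      exact nonempty_linearEquiv_of_exact (LocalizedModule.exact_map S h2)
        (LocalizedModule.map_surjective S δ h1) h2' h1'
        (localizedPrimaryComponentEquiv S a I) (localizedPrimaryComponentEquiv S a _)
        (localizedPrimaryComponentEquiv_naturality S a _)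
    | succ n =>
      obtain ⟨e⟩ := nonempty_shiftEquiv a hf hfg hg n
      obtain ⟨e'⟩ := nonempty_shiftEquiv (a.map (algebraMap R (Localization S))) hf' hfg' hg' n
      obtain ⟨e''⟩ := ih (I ⧸ LinearMap.range f)
      exact ⟨((LocalizedModule.congr S e.symm).trans e'').trans e'⟩

end Localization

/-! ### Torsion submodules of injective modules -/

section Torsion

variable {R : Type u} [CommRing R] (a : Ideal R)

/-- A finitely generated submodule of an `a`-torsion module is killed by a single power of `a`. -/
lemma Submodule.FG.exists_pow_smul_eq_zero {L : Type*} [AddCommGroup L] [Module R L]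
    (hL : IsPowerTorsion a L) {N : Submodule R L} (hN : N.FG) :
    ∃ n : ℕ, ∀ r ∈ a ^ n, ∀ y ∈ N, r • y = 0 := by
  obtain ⟨T, rfl⟩ := hN
  choose e he using hL
  refine ⟨T.sup e, fun r hr y hy => ?_⟩
  have hle : Submodule.span R (T : Set L) ≤ LinearMap.ker (DistribSMul.toLinearMap R L r) :=
    Submodule.span_le.2 fun z hz => he z r (Ideal.pow_le_pow_right (Finset.le_sup hz) hr)
  exact hle hy

/-- Over a Noetherian ring `Γ_a` preserves injective modules. By Baer's criterion it is enough to
extend `g : J → Γ_a(I)` from an ideal `J`. By Artin-Rees `g` factors through `J / (J ∩ aᵐ)`, and an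
extension `R / aᵐ → I` of the resulting map has its values in `Γ_a(I)`. -/
instance injective_primaryComponent [IsNoetherianRing R] (I : Type u) [AddCommGroup I]
    [Module R I] [Module.Injective R I] : Module.Injective R (a.primaryComponent I) := by
  refine Module.Baer.injective fun J g => ?_
  have hfin : (LinearMap.range g).FG := Module.Finite.iff_fg.1 inferInstance
  obtain ⟨n, hn⟩ := hfin.exists_pow_smul_eq_zero a isPowerTorsion_primaryComponent
  -- Artin-Rees gives `J ∩ aⁿ⁺ᵏ ⊆ aⁿ J`, and `aⁿ` kills the image of `g`
  obtain ⟨k, hk⟩ := Ideal.exists_pow_inf_eq_pow_smul a J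
  let m := n + k
  have hker (x : J) (hx : (x : R) ∈ a ^ m) : g x = 0 := by
    have h1 : (x : R) ∈ a ^ m • (⊤ : Submodule R R) ⊓ J := ⟨by simpa using hx, x.2⟩
    rw [hk m (Nat.le_add_left k n), show m - k = n from Nat.add_sub_cancel n k] at h1
    have h2 : a ^ n • (a ^ k • (⊤ : Submodule R R) ⊓ J) ≤ (LinearMap.ker g).map J.subtype := by
      refine Submodule.smul_le.2 fun r hr y hy => ?_
      refine ⟨r • ⟨y, hy.2⟩, ?_, rfl⟩
      rw [SetLike.mem_coe, LinearMap.mem_ker, map_smul]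
      exact hn r hr _ ⟨_, rfl⟩
    obtain ⟨z, hz, hzx⟩ := h2 h1
    rwa [← Subtype.ext hzx]
  let φ : J →ₗ[R] R ⧸ a ^ m := (a ^ m).mkQ ∘ₗ J.subtype
  have hφ (x : J) : φ x = 0 ↔ (x : R) ∈ a ^ m := Submodule.Quotient.mk_eq_zero _
  obtain ⟨h, hh⟩ := Module.Injective.out (R := R) (Q := I)
    ((LinearMap.ker φ).liftQ φ le_rfl)
    (LinearMap.ker_eq_bot.1 (Submodule.ker_liftQ_eq_bot _ _ _ le_rfl))
    ((LinearMap.ker φ).liftQ ((a.primaryComponent I).subtype ∘ₗ g) fun x hx => by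
      rw [LinearMap.mem_ker, LinearMap.comp_apply, hker x ((hφ x).1 hx), map_zero])
  refine ⟨LinearMap.codRestrict _ (h ∘ₗ (a ^ m).mkQ) fun r => mem_primaryComponent_iff.2
    ⟨m, fun s hs => ?_⟩, fun x hx => Subtype.ext (hh (Submodule.Quotient.mk ⟨x, hx⟩))⟩
  rw [← map_smul, LinearMap.comp_apply]
  have : (a ^ m).mkQ (s • r) = 0 :=
    (Submodule.Quotient.mk_eq_zero _).2 (Ideal.mul_mem_right r _ hs)
  rw [this, map_zero]

end Torsion

/-! ### Finiteness of `Ext` along exact sequences -/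

section ExtFinite

variable {R : Type u} [CommRing R] (X : ModuleCat.{u} R)

open Abelian

/-- The module `Ext^j(X, L)` is finitely generated. -/
abbrev ExtFinite (j : ℕ) (L : Type u) [AddCommGroup L] [Module R L] : Prop :=
  Module.Finite R (Ext X (ModuleCat.of R L) j)

/-- Exactness in the middle is only needed in one direction: `ker g ≤ range f`. -/
lemma module_finite_of_exact [IsNoetherianRing R] {A B C : Type*} [AddCommGroup A] [Module R A]
    [AddCommGroup B] [Module R B] [AddCommGroup C] [Module R C]
    [Module.Finite R A] [Module.Finite R C]
    (f : A →ₗ[R] B) (g : B →ₗ[R] C) (h : ∀ x, g x = 0 → ∃ y, f y = x) : Module.Finite R B := by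
  have hN : IsNoetherian R C := inferInstance
  have h1 : (LinearMap.ker g).FG := by
    have : LinearMap.ker g = (LinearMap.ker (g ∘ₗ f)).map f := by
      ext x
      constructor
      · intro hx
        obtain ⟨y, rfl⟩ := h x hx
        exact ⟨y, hx, rfl⟩
      · rintro ⟨y, hy, rfl⟩
        exact hy
    rw [this]
    exact (IsNoetherian.noetherian _).map f
  have : Module.Finite R (LinearMap.ker g) := Module.Finite.iff_fg.2 h1
  have : Module.Finite R (B ⧸ LinearMap.ker g) :=
    Module.Finite.equiv g.quotKerEquivRange.symm
  exact Module.Finite.of_submodule_quotient (LinearMap.ker g)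

variable {X} {A B C : Type u} [AddCommGroup A] [Module R A] [AddCommGroup B] [Module R B]
  [AddCommGroup C] [Module R C] {f : A →ₗ[R] B} {g : B →ₗ[R] C}

lemma shortExact_of_exact (hf : Function.Injective f) (hfg : Function.Exact f g)
    (hg : Function.Surjective g) :
    (ShortComplex.mk (ModuleCat.ofHom f) (ModuleCat.ofHom g)
      (by ext x; exact hfg.apply_apply_eq_zero x)).ShortExact :=
  ModuleCat.shortComplex_shortExact _ hfg hf hg

lemma ExtFinite.middle [IsNoetherianRing R] (hf : Function.Injective f) (hfg : Function.Exact f g)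
    (hg : Function.Surjective g) {j : ℕ} (hA : ExtFinite X j A) (hC : ExtFinite X j C) :
    ExtFinite X j B :=
  module_finite_of_exact
    ((Ext.mk₀ (ModuleCat.ofHom f)).postcompOfLinear R X (add_zero j))
    ((Ext.mk₀ (ModuleCat.ofHom g)).postcompOfLinear R X (add_zero j))
    fun x hx => Ext.covariant_sequence_exact₂ X (shortExact_of_exact hf hfg hg) x hx

lemma ExtFinite.right [IsNoetherianRing R] (hf : Function.Injective f) (hfg : Function.Exact f g)
    (hg : Function.Surjective g) {j : ℕ} (hB : ExtFinite X j B) (hA : ExtFinite X (j + 1) A) :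
    ExtFinite X j C :=
  module_finite_of_exact
    ((Ext.mk₀ (ModuleCat.ofHom g)).postcompOfLinear R X (add_zero j))
    ((shortExact_of_exact hf hfg hg).extClass.postcompOfLinear R X (rfl : j + 1 = j + 1))
    fun x hx => Ext.covariant_sequence_exact₃ X (shortExact_of_exact hf hfg hg) x rfl hx

lemma extFinite_succ_of_injective (I : Type u) [AddCommGroup I] [Module R I]
    [Module.Injective R I] (j : ℕ) : ExtFinite X (j + 1) I := by
  have : Injective (ModuleCat.of R I) := Module.injective_object_of_injective_module R I
  have : Subsingleton (Ext X (ModuleCat.of R I) (j + 1)) :=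
    subsingleton_of_forall_eq 0 Ext.eq_zero_of_injective
  infer_instance

lemma ExtFinite.congr (e : A ≃ₗ[R] B) {j : ℕ} (h : ExtFinite X j A) : ExtFinite X j B := by
  refine Module.Finite.of_surjective
    ((Ext.mk₀ (ModuleCat.ofHom e.toLinearMap)).postcompOfLinear R X (add_zero j)) fun x =>
    ⟨x.comp (Ext.mk₀ (ModuleCat.ofHom e.symm.toLinearMap)) (add_zero j), ?_⟩
  change (x.comp _ (add_zero j)).comp (Ext.mk₀ (ModuleCat.ofHom e.toLinearMap)) (add_zero j) = x
  rw [Ext.comp_assoc_of_second_deg_zero, Ext.mk₀_comp_mk₀]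
  have : ModuleCat.ofHom e.symm.toLinearMap ≫ ModuleCat.ofHom e.toLinearMap = 𝟙 _ := by
    ext x; exact e.apply_symm_apply x
  rw [this, Ext.comp_mk₀_id]

end ExtFinite

/-! ### Finiteness of `Hom(R/a, H^r_a(M))` -/

section Exactness

variable {R : Type u} [CommRing R] (a : Ideal R)

lemma Function.Exact.subtype_range {A B C : Type*} [AddCommGroup A] [Module R A]
    [AddCommGroup B] [Module R B] [AddCommGroup C] [Module R C] {i : A →ₗ[R] B} {q : B →ₗ[R] C}
    (h : Function.Exact i q) : Function.Exact (LinearMap.range i).subtype q := fun x =>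
  (h x).trans ⟨fun ⟨y, hy⟩ => ⟨⟨x, y, hy⟩, rfl⟩, fun ⟨z, hz⟩ => hz ▸ z.2⟩

/-- Left exactness of `Γ_a`. -/
lemma exact_primaryComponent_map {M I Q : Type*} [AddCommGroup M] [Module R M] [AddCommGroup I]
    [Module R I] [AddCommGroup Q] [Module R Q] {f : M →ₗ[R] I} {g : I →ₗ[R] Q}
    (hf : Function.Injective f) (hfg : Function.Exact f g) :
    Function.Exact (Ideal.primaryComponent.map a f) (Ideal.primaryComponent.map a g) := by
  rintro ⟨x, hx⟩
  constructor
  · intro h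
    obtain ⟨y, rfl⟩ := (hfg x).1 (congr_arg Subtype.val h)
    obtain ⟨n, hn⟩ := mem_primaryComponent_iff.1 hx
    refine ⟨⟨y, mem_primaryComponent_iff.2 ⟨n, fun r hr => hf ?_⟩⟩, rfl⟩
    rw [map_smul, hn r hr, map_zero]
  · rintro ⟨y, hy⟩
    rw [← hy]
    exact Subtype.ext (hfg.apply_apply_eq_zero y.1)

lemma module_finite_range_of_ker_le {A B C : Type*} [AddCommGroup A] [Module R A] [AddCommGroup B]
    [Module R B] [AddCommGroup C] [Module R C] [IsNoetherian R B] (φ : A →ₗ[R] B) (σ : A →ₗ[R] C)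
    (h : LinearMap.ker φ ≤ LinearMap.ker σ) : Module.Finite R (LinearMap.range σ) := by
  have : Module.Finite R (A ⧸ LinearMap.ker φ) := Module.Finite.equiv φ.quotKerEquivRange.symm
  have : Module.Finite R (A ⧸ LinearMap.ker σ) :=
    Module.Finite.of_surjective _ (Submodule.factor_surjective h)
  exact Module.Finite.equiv σ.quotKerEquivRange

end Exactness

section HomFinite

variable {R : Type u} [CommRing R] [IsNoetherianRing R] (a : Ideal R)

open Abelian

variable {M I Q C : Type u} [AddCommGroup M] [Module R M] [AddCommGroup I]
    [Module R I] [AddCommGroup Q] [Module R Q] [AddCommGroup C] [Module R C]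
    {f : M →ₗ[R] I} {g : I →ₗ[R] Q}

/-- Let `0 → M → I → Q` be exact with `I` injective and let `B` be the image of `Γ_a(I) → Γ_a(Q)`.
Since `0 → Γ_a(M) → Γ_a(I) → B → 0` is exact and `Γ_a(I)` is injective, `Ext^{j+1}(X, B)` inherits
finiteness from `Ext^{j+2}(X, Γ_a(M))`. -/
lemma extFinite_range_primaryComponent_map [Module.Injective R I]
    (hf : Function.Injective f) (hfg : Function.Exact f g) {X : ModuleCat.{u} R} {j : ℕ}
    (h : ExtFinite X (j + 2) (a.primaryComponent M)) :
    ExtFinite X (j + 1) (LinearMap.range (Ideal.primaryComponent.map a g)) := by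
  refine ExtFinite.right (f := Ideal.primaryComponent.map a f)
    (g := (Ideal.primaryComponent.map a g).rangeRestrict) ?_ ?_
    (LinearMap.surjective_rangeRestrict _) (extFinite_succ_of_injective _ j) h
  · intro x y hxy
    exact Subtype.ext (hf (congr_arg Subtype.val hxy))
  · intro x
    rw [← exact_primaryComponent_map a hf hfg x, Subtype.ext_iff]
    rfl

/-- Let `0 → M → I → Q → 0` be exact, and let `C`, which is `H¹_a(M)` if `I` is injective, be the
cokernel of `Γ_a(I) → Γ_a(Q)`, with `B` the image of that map. If `Ext¹(R/a, M)` and `Ext¹(R/a, B)`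
are finitely generated, so is `Hom(R/a, C)`. The cokernel of `Hom(R/a, Γ_a(Q)) → Hom(R/a, C)` embeds
into `Ext¹(R/a, B)`, and the image of that map is a quotient of a submodule of `Ext¹(R/a, M)`. -/
lemma extFinite_zero_cokernel
    (hf : Function.Injective f) (hfg : Function.Exact f g) (hg : Function.Surjective g)
    {δ : a.primaryComponent Q →ₗ[R] C} (hδ : Function.Surjective δ)
    (hgδ : Function.Exact (Ideal.primaryComponent.map a g) δ)
    (hM : ExtFinite (ModuleCat.of R (R ⧸ a)) 1 M)
    (hB : ExtFinite (ModuleCat.of R (R ⧸ a)) 1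
      (LinearMap.range (Ideal.primaryComponent.map a g))) :
    ExtFinite (ModuleCat.of R (R ⧸ a)) 0 C := by
  have hS := shortExact_of_exact hf hfg hg
  have hS' := shortExact_of_exact (f := (LinearMap.range (Ideal.primaryComponent.map a g)).subtype)
    (g := δ) (Submodule.subtype_injective _) hgδ.subtype_range hδ
  let φ := hS.extClass.postcompOfLinear R (ModuleCat.of R (R ⧸ a)) (rfl : 0 + 1 = 1) ∘ₗ
    (Ext.mk₀ (ModuleCat.ofHom (a.primaryComponent Q).subtype)).postcompOfLinear R
      (ModuleCat.of R (R ⧸ a)) (add_zero 0)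
  let σ := (Ext.mk₀ (ModuleCat.ofHom δ)).postcompOfLinear R (ModuleCat.of R (R ⧸ a)) (add_zero 0)
  -- A map `h : R/a → Γ_a(Q)` that dies in `Ext¹(R/a, M)` lifts to `R/a → I`. The lift has
  -- values in `Γ_a(I)`, so `h` has its values in `B` and dies in `C`.
  have hle : LinearMap.ker φ ≤ LinearMap.ker σ := by
    intro x hx
    obtain ⟨h, rfl⟩ := Ext.addEquiv₀.symm.surjective x
    obtain ⟨y, hy⟩ := Ext.covariant_sequence_exact₃ _ hS
      ((Ext.mk₀ h).comp (Ext.mk₀ (ModuleCat.ofHom (a.primaryComponent Q).subtype)) (add_zero 0))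
      rfl hx
    obtain ⟨k, rfl⟩ := Ext.addEquiv₀.symm.surjective y
    change (Ext.mk₀ k).comp (Ext.mk₀ _) _ = _ at hy
    rw [Ext.mk₀_comp_mk₀, Ext.mk₀_comp_mk₀] at hy
    have hkh : k ≫ ModuleCat.ofHom g = h ≫ ModuleCat.ofHom (a.primaryComponent Q).subtype :=
      Ext.addEquiv₀.symm.injective hy
    change (Ext.mk₀ h).comp (Ext.mk₀ (ModuleCat.ofHom δ)) (add_zero 0) = 0
    rw [Ext.mk₀_comp_mk₀]
    have hz : h ≫ ModuleCat.ofHom δ = 0 := by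
      refine ModuleCat.hom_ext (LinearMap.ext fun (z : R ⧸ a) => ?_)
      refine (hgδ (h z)).2 ⟨⟨k z, mem_primaryComponent_iff.2 ⟨1, fun r hr => ?_⟩⟩,
        Subtype.ext (LinearMap.congr_fun (congr_arg ModuleCat.Hom.hom hkh) z)⟩
      rw [pow_one] at hr
      have : r • z = 0 := by
        obtain ⟨z, rfl⟩ := Ideal.Quotient.mk_surjective z
        exact Ideal.Quotient.eq_zero_iff_mem.2 (Ideal.mul_mem_right z a hr)
      rw [← map_smul, this, map_zero]
    rw [hz, Ext.mk₀_zero]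
  have hfin := module_finite_range_of_ker_le φ σ hle
  exact module_finite_of_exact (LinearMap.range σ).subtype
    (hS'.extClass.postcompOfLinear R (ModuleCat.of R (R ⧸ a)) (rfl : 0 + 1 = 1)) fun x hx => by
      obtain ⟨y, hy⟩ := Ext.covariant_sequence_exact₃ _ hS' x rfl hx
      exact ⟨⟨x, y, hy⟩, rfl⟩

/-- If `Ext^{r+1}(R/a, M)` is finitely generated and `H^0_a(M), …, H^r_a(M)` have finitely generated
`Ext^{j+1}(R/a, -)` for all `j`, then `Hom(R/a, H^{r+1}_a(M))` is finitely generated. For `r > 0`,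
replace `M` by the cokernel `Q` of an embedding into an injective module: all local cohomology
modules of `Q` in positive degree are those of `M` shifted, and `Γ_a(Q)` is an extension of
`H^1_a(M)` by a module controlled by `Γ_a(M)`. -/
theorem extFinite_zero_localCohomology (r : ℕ) (M : Type u) [AddCommGroup M] [Module R M]
    (hM : ExtFinite (ModuleCat.of R (R ⧸ a)) (r + 1) M)
    (h0 : ∀ j, ExtFinite (ModuleCat.of R (R ⧸ a)) (j + 1) (a.primaryComponent M))
    (hH : ∀ i, i < r → ∀ j, ExtFinite (ModuleCat.of R (R ⧸ a)) (j + 1) (LocalCoh a (i + 1) M)) :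
    ExtFinite (ModuleCat.of R (R ⧸ a)) 0 (LocalCoh a (r + 1) M) := by
  induction r generalizing M with
  | zero =>
    obtain ⟨I, _, _, f, _, hf⟩ := exists_injective_embedding R M
    have hfg := LinearMap.exact_map_mkQ_range f
    have hg := Submodule.mkQ_surjective (LinearMap.range f)
    obtain ⟨δ, h1, h2⟩ := localCohomology.exists_connecting_zero a hf hfg hg
    exact extFinite_zero_cokernel a hf hfg hg h1 h2 hM
      (extFinite_range_primaryComponent_map a hf hfg (h0 1))
  | succ r ih =>
    obtain ⟨I, _, _, f, _, hf⟩ := exists_injective_embedding R M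
    have hfg := LinearMap.exact_map_mkQ_range f
    have hg := Submodule.mkQ_surjective (LinearMap.range f)
    obtain ⟨δ, h1, h2⟩ := localCohomology.exists_connecting_zero a hf hfg hg
    obtain ⟨e⟩ := localCohomology.nonempty_shiftEquiv a hf hfg hg r
    refine (ih (I ⧸ LinearMap.range f) ?_ ?_ ?_).congr e
    · exact ExtFinite.right hf hfg hg (extFinite_succ_of_injective I r) hM
    · intro j
      exact ExtFinite.middle (Submodule.subtype_injective (LinearMap.range
        (Ideal.primaryComponent.map a (LinearMap.range f).mkQ))) h2.subtype_range h1
        (extFinite_range_primaryComponent_map a hf hfg (h0 (j + 1))) (hH 0 r.succ_pos j)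
    · intro i hi j
      obtain ⟨e'⟩ := localCohomology.nonempty_shiftEquiv a hf hfg hg i
      exact (hH (i + 1) (Nat.succ_lt_succ hi) j).congr e'.symm

/-- If `Hom(R/a, L)` is finitely generated then so is `(0 :_L a)`. -/
lemma ExtFinite.finite_torsionBySet {L : Type u} [AddCommGroup L] [Module R L]
    (h : ExtFinite (ModuleCat.of R (R ⧸ a)) 0 L) :
    Module.Finite R (Submodule.torsionBySet R L (a : Set R)) := by
  let ev : Ext (ModuleCat.of R (R ⧸ a)) (ModuleCat.of R L) 0 →ₗ[R] L :=
    LinearMap.applyₗ (Ideal.Quotient.mk a 1) ∘ₗ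
      (ModuleCat.homLinearEquiv (S := R)).toLinearMap ∘ₗ
      (Ext.linearEquiv₀ (R := R)).toLinearMap
  have hle : Submodule.torsionBySet R L (a : Set R) ≤ LinearMap.range ev := by
    intro y hy
    rw [Submodule.mem_torsionBySet_iff] at hy
    refine ⟨(Ext.linearEquiv₀ (R := R)).symm (ModuleCat.ofHom (Submodule.liftQ a
      (LinearMap.toSpanSingleton R L y) fun r hr => hy ⟨r, hr⟩)), ?_⟩
    change ModuleCat.homLinearEquiv (S := R) (Ext.linearEquiv₀ (R := R)
      ((Ext.linearEquiv₀ (R := R)).symm _)) _ = _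
    rw [LinearEquiv.apply_symm_apply]
    exact one_smul R y
  exact Module.Finite.of_injective (Submodule.inclusion hle) (Submodule.inclusion_injective hle)

end HomFinite

/-! ### Criteria for a module to be Artinian -/

section Artinian

variable {R : Type*} [CommRing R]

open Submodule

/-- **Melkersson's criterion** for a principal ideal: if every element of `L` is killed by a power
of `x` and `(0 :_L x)` is Artinian, then `L` is Artinian. For a decreasing sequence of submodules
`Fₙ` of `L`, put `K n k = xᵏ Fₙ ∩ (0 :_L x)`. These submodules of `(0 :_L x)` decrease in `n` and in
`k`, so they become independent of `n` uniformly in `k`; induction on the power of `x` killing an element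
then shows that `Fₙ` is stationary. -/
theorem isArtinian_of_isArtinian_torsionBy {L : Type*} [AddCommGroup L] [Module R L] (x : R)
    (hx : ∀ y : L, ∃ n : ℕ, x ^ n • y = 0) [IsArtinian R (torsionBy R L x)] : IsArtinian R L := by
  refine monotone_stabilizes_iff_artinian.1 fun f => ?_
  let F : ℕ → Submodule R L := fun n => OrderDual.ofDual (f n)
  have hF : Antitone F := f.monotone
  let K : ℕ → ℕ → Submodule R (torsionBy R L x) := fun n k =>
    (map (DistribSMul.toLinearMap R L (x ^ k)) (F n)).comap (torsionBy R L x).subtype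
  have mem_K {n k : ℕ} {z : torsionBy R L x} : z ∈ K n k ↔ ∃ y ∈ F n, x ^ k • y = z := Iff.rfl
  have hK1 (k : ℕ) : Antitone fun n => K n k :=
    fun n n' h => comap_mono (map_mono (hF h))
  have hK2 (n : ℕ) : Antitone (K n) := by
    refine antitone_nat_of_succ_le fun k z hz => ?_
    obtain ⟨y, hy, hyz⟩ := mem_K.1 hz
    exact mem_K.2 ⟨x • y, smul_mem _ _ hy, by rw [← hyz, smul_smul, pow_succ]⟩
  -- beyond a minimal element of the family `K` nothing changes; only `k < k₀` remain to be treated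
  obtain ⟨_, ⟨⟨n₀, k₀⟩, rfl⟩, hmin⟩ := WellFounded.has_min
    (wellFounded_lt (α := Submodule R (torsionBy R L x)))
    (Set.range fun i : ℕ × ℕ => K i.1 i.2) (Set.range_nonempty _)
  have hmin' {n k : ℕ} (hn : n₀ ≤ n) (hk : k₀ ≤ k) : K n k = K n₀ k₀ := by
    refine eq_of_le_of_not_lt ((hK2 n hk).trans (hK1 k₀ hn)) (hmin _ ⟨(n, k), rfl⟩)
  have hstab (k : ℕ) : ∃ N, ∀ n, N ≤ n → K N k = K n k :=
    monotone_stabilizes_iff_artinian.2 ‹IsArtinian R (torsionBy R L x)›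
      ⟨fun n => OrderDual.toDual (K n k), fun _ _ h => hK1 k h⟩
  choose N hN using hstab
  let N₁ := max n₀ ((Finset.range k₀).sup N)
  have hconst {n : ℕ} (hn : N₁ ≤ n) (k : ℕ) : K n k = K N₁ k := by
    rcases le_or_gt k₀ k with hk | hk
    · rw [hmin' ((le_max_left _ _).trans hn) hk, hmin' (le_max_left _ _) hk]
    · have h1 : N k ≤ N₁ :=
        (Finset.le_sup (f := N) (Finset.mem_range.2 hk)).trans (le_max_right _ _)
      rw [← hN k n (h1.trans hn), ← hN k N₁ h1]
  refine ⟨N₁, fun n hn => ?_⟩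
  change F N₁ = F n
  refine le_antisymm (fun y hy => ?_) (hF hn)
  obtain ⟨k, hk⟩ := hx y
  induction k generalizing y with
  | zero => rw [pow_zero, one_smul] at hk; exact hk ▸ zero_mem _
  | succ k ih =>
    have hz : x ^ k • y ∈ torsionBy R L x := by
      rw [mem_torsionBy_iff, smul_smul, ← pow_succ', hk]
    have h1 : (⟨x ^ k • y, hz⟩ : torsionBy R L x) ∈ K N₁ k := mem_K.2 ⟨y, hy, rfl⟩
    rw [← hconst hn k] at h1
    obtain ⟨w, hw, hwy⟩ := mem_K.1 h1
    have h2 : y - w ∈ F n := ih (y - w) (sub_mem hy (hF hn hw)) (by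
      rw [smul_sub, hwy, sub_self])
    simpa using add_mem h2 hw

lemma isArtinian_of_isArtinian_torsionBySet_finset (T : Finset R) {L : Type*} [AddCommGroup L]
    [Module R L] (hT : ∀ x ∈ T, ∀ y : L, ∃ n : ℕ, x ^ n • y = 0)
    [IsArtinian R (torsionBySet R L (T : Set R))] : IsArtinian R L := by
  classical
  induction T using Finset.induction_on generalizing L with
  | empty =>
    refine isArtinian_of_injective
      (LinearMap.codRestrict (torsionBySet R L ((∅ : Finset R) : Set R)) LinearMap.id fun x => ?_)
      fun x y h => congr_arg Subtype.val h
    simp [mem_torsionBySet_iff]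
  | insert x T _ ih =>
    have : IsArtinian R (torsionBySet R (torsionBy R L x) (T : Set R)) := by
      refine isArtinian_of_injective (LinearMap.codRestrict
        (torsionBySet R L ((insert x T : Finset R) : Set R))
        ((torsionBy R L x).subtype ∘ₗ Submodule.subtype _) fun z => ?_)
        fun z w h => ?_
      · rw [mem_torsionBySet_iff]
        rintro ⟨r, hr⟩
        rcases Finset.mem_insert.1 hr with rfl | hr
        · exact z.1.2
        · exact congr_arg Subtype.val (((mem_torsionBySet_iff _ _).1 z.2) ⟨r, hr⟩)
      · have h' := congr_arg Subtype.val h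
        exact Subtype.ext (Subtype.ext h')
    have : IsArtinian R (torsionBy R L x) := ih fun r hr y => by
      obtain ⟨n, hn⟩ := hT r (Finset.mem_insert_of_mem hr) y
      exact ⟨n, Subtype.ext hn⟩
    exact isArtinian_of_isArtinian_torsionBy x (hT x (Finset.mem_insert_self x T))

/-- **Melkersson's criterion**: an `a`-torsion module `L` is Artinian if `(0 :_L a)` is. -/
theorem IsPowerTorsion.isArtinian {a : Ideal R} (ha : a.FG) {L : Type*} [AddCommGroup L]
    [Module R L] (hL : IsPowerTorsion a L) [h : IsArtinian R (torsionBySet R L (a : Set R))] :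
    IsArtinian R L := by
  obtain ⟨T, rfl⟩ := ha
  have : IsArtinian R (torsionBySet R L (T : Set R)) := by
    rwa [torsionBySet_eq_torsionBySet_span]
  refine isArtinian_of_isArtinian_torsionBySet_finset T fun x hx y => ?_
  obtain ⟨n, hn⟩ := hL y
  exact ⟨n, hn _ (Ideal.pow_mem_pow (Ideal.subset_span hx) n)⟩

/-- A finitely generated module `N` whose associated primes are maximal is Artinian: the minimal
primes of its annihilator are associated, so `R / ann N` is a Noetherian ring of dimension zero. -/
theorem isArtinian_of_associatedPrimes_isMaximal [IsNoetherianRing R] {N : Type*} [AddCommGroup N]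
    [Module R N] [Module.Finite R N] (h : ∀ p ∈ associatedPrimes R N, p.IsMaximal) :
    IsArtinian R N := by
  let c := Module.annihilator R N
  have hdim : Ring.KrullDimLE 0 (R ⧸ c) := by
    refine Ring.krullDimLE_zero_iff.2 fun P hP => ?_
    have hle : c ≤ P.comap (Ideal.Quotient.mk c) := fun r hr => by
      rw [Ideal.mem_comap, Ideal.Quotient.eq_zero_iff_mem.2 hr]; exact zero_mem _
    obtain ⟨q, hq, hqP⟩ := Ideal.exists_minimalPrimes_le hle
    have hqm := h q
      (Module.associatedPrimes.minimalPrimes_annihilator_subset_associatedPrimes R N hq)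
    have hmax : (P.comap (Ideal.Quotient.mk c)).IsMaximal := by
      rwa [← hqm.eq_of_le (Ideal.IsPrime.ne_top inferInstance) hqP]
    have := Ideal.map_eq_top_or_isMaximal_of_surjective (Ideal.Quotient.mk c)
      Ideal.Quotient.mk_surjective hmax
    rw [Ideal.map_comap_of_surjective _ Ideal.Quotient.mk_surjective] at this
    exact this.resolve_left hP.ne_top
  have : IsArtinianRing (R ⧸ c) := IsNoetherianRing.isArtinianRing_of_krullDimLE_zero
  let _ : Module (R ⧸ c) N := Module.quotientAnnihilator
  have : Module.Finite (R ⧸ c) N := Module.Finite.of_restrictScalars_finite R _ _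
  have : IsArtinian (R ⧸ c) N := inferInstance
  exact isArtinian_of_surjective_algebraMap (R := R ⧸ c) Ideal.Quotient.mk_surjective

end Artinian

/-! ### Minimax multiples of a torsion module -/

section Minimax

variable {R : Type u} [CommRing R] {L : Type u} [AddCommGroup L] [Module R L]

lemma isMinimax_of_isArtinian (X : Submodule R L) [IsArtinian R X] : IsMinimax R X :=
  ⟨⊥, Submodule.fg_bot, inferInstance⟩

/-- If `X` is a minimax submodule of an `a`-torsion module and `b ≤ a`, then some `b ^ n X` is
Artinian: a power of `b` kills the finitely generated part `N` of `X`, so `b ^ n X` is a sum of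
finitely many quotients of `X / N`. -/
lemma IsMinimax.exists_isArtinian {a b : Ideal R} (hb : b.FG) (hba : b ≤ a)
    (hL : IsPowerTorsion a L) {X : Submodule R L} (hX : IsMinimax R X) :
    ∃ n : ℕ, IsArtinian R (b ^ n • X : Submodule R L) := by
  obtain ⟨N, hN, hNX⟩ := hX
  obtain ⟨n, hn⟩ := hN.exists_pow_smul_eq_zero a (hL.of_injective X.subtype X.subtype_injective)
  obtain ⟨G, hG⟩ := Ideal.FG.pow (n := n) hb
  have hGn (r : G) : (r : R) ∈ a ^ n :=
    Ideal.pow_right_mono hba n (hG ▸ Ideal.subset_span r.2)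
  refine ⟨n, ?_⟩
  -- multiplication by each generator of `b ^ n` factors through `X / N`
  let ψ : (G → X ⧸ N) →ₗ[R] L := ∑ r : G,
    (Submodule.liftQ N (X.subtype ∘ₗ DistribSMul.toLinearMap R X (r : R)) fun y hy => by
        rw [LinearMap.mem_ker]
        exact congr_arg Subtype.val (hn r (hGn r) y hy)) ∘ₗ LinearMap.proj r
  have hle : b ^ n • X ≤ LinearMap.range ψ := by
    refine Submodule.smul_le.2 fun r hr x hx => ?_
    have h : b ^ n ≤ (LinearMap.range ψ).comap (LinearMap.toSpanSingleton R L x) := by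
      rw [← hG]
      refine Ideal.span_le.2 fun g hg => ?_
      classical
      refine ⟨Pi.single (⟨g, hg⟩ : G) (Submodule.Quotient.mk ⟨x, hx⟩), ?_⟩
      rw [LinearMap.sum_apply, Finset.sum_eq_single (⟨g, hg⟩ : G)]
      · simp
      · intro r _ hr
        simp [Pi.single_eq_of_ne hr]
      · simp
    exact h hr
  exact isArtinian_of_le hle

/-- For an `a`-torsion module `L` and `b ≤ a`, some `b ^ t L` is minimax if and only if some
`b ^ t L` is Artinian. -/
lemma exists_isMinimax_pow_smul_iff {a b : Ideal R} (hb : b.FG) (hba : b ≤ a)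
    (hL : IsPowerTorsion a L) :
    (∃ t : ℕ, 1 ≤ t ∧ IsMinimax R (b ^ t • (⊤ : Submodule R L) : Submodule R L)) ↔
      ∃ t : ℕ, IsArtinian R (b ^ t • (⊤ : Submodule R L) : Submodule R L) := by
  constructor
  · rintro ⟨t, -, ht⟩
    obtain ⟨n, hn⟩ := ht.exists_isArtinian hb hba hL
    rw [← mul_smul, ← pow_add] at hn
    exact ⟨n + t, hn⟩
  · rintro ⟨t, ht⟩
    -- `t` may be `0`, whereas the minimaxness dimension asks for a positive exponent
    have : IsArtinian R (b ^ (t + 1) • (⊤ : Submodule R L) : Submodule R L) :=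
      isArtinian_of_le (Submodule.smul_mono_left (Ideal.pow_le_pow_right t.le_succ))
    exact ⟨t + 1, by omega, isMinimax_of_isArtinian _⟩

lemma isArtinian_pow_smul_top_congr {L' : Type*} [AddCommGroup L'] [Module R L'] (e : L ≃ₗ[R] L')
    (c : Ideal R) [h : IsArtinian R (c • (⊤ : Submodule R L) : Submodule R L)] :
    IsArtinian R (c • (⊤ : Submodule R L') : Submodule R L') := by
  have := isArtinian_of_linearEquiv (e.submoduleMap (c • (⊤ : Submodule R L)))
  rw [Submodule.map_smul'', Submodule.map_top] at this
  rwa [← LinearMap.range_eq_top.2 e.surjective]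

end Minimax

/-! ### Artinianness of `b ^ t L`, locally and globally -/

section LocalGlobal

variable {R : Type u} [CommRing R] {L : Type u} [AddCommGroup L] [Module R L]

lemma mk_mem_map_smul_top (S : Submonoid R) (c : Ideal R) {x : L}
    (hx : x ∈ c • (⊤ : Submodule R L)) (s : S) :
    LocalizedModule.mk x s ∈ (c.map (algebraMap R (Localization S)) •
      (⊤ : Submodule (Localization S) (LocalizedModule S L))) := by
  induction hx using Submodule.smul_induction_on' with
  | smul r hr y _ =>
    have : LocalizedModule.mk (r • y) s =
        algebraMap R (Localization S) r • LocalizedModule.mk y s := by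
      rw [algebraMap_smul, LocalizedModule.smul'_mk]
    rw [this]
    exact Submodule.smul_mem_smul (Ideal.mem_map_of_mem _ hr) trivial
  | add x _ y _ hx hy =>
    have : LocalizedModule.mk (x + y) s = LocalizedModule.mk x s + LocalizedModule.mk y s := by
      rw [LocalizedModule.mk_add_mk, ← smul_add, LocalizedModule.mk_cancel_common_left]
    rw [this]
    exact add_mem hx hy

lemma exists_mk_of_mem_map_smul_top (S : Submonoid R) (c : Ideal R) {w : LocalizedModule S L}
    (hw : w ∈ (c.map (algebraMap R (Localization S)) •
      (⊤ : Submodule (Localization S) (LocalizedModule S L)))) :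
    ∃ x ∈ c • (⊤ : Submodule R L), ∃ s : S, w = LocalizedModule.mk x s := by
  induction hw using Submodule.smul_induction_on' with
  | smul z hz y _ =>
    obtain ⟨⟨⟨r, hr⟩, s⟩, hrs⟩ := (IsLocalization.mem_map_algebraMap_iff S _).1 hz
    induction y using LocalizedModule.induction_on with
    | h y t =>
    refine ⟨r • y, Submodule.smul_mem_smul hr trivial, s * t, ?_⟩
    have hz : z = Localization.mk r s := by
      rw [Localization.mk_eq_mk', IsLocalization.eq_mk'_iff_mul_eq]
      exact hrs
    rw [hz, LocalizedModule.mk_smul_mk]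
  | add x _ y _ hx hy =>
    obtain ⟨x, hx, s, rfl⟩ := hx
    obtain ⟨y, hy, t, rfl⟩ := hy
    exact ⟨t • x + s • y, add_mem (Submodule.smul_mem _ _ hx) (Submodule.smul_mem _ _ hy), s * t,
      LocalizedModule.mk_add_mk⟩

/-- Localization preserves Artinianness of `c L`. -/
lemma isArtinian_map_smul_top (S : Submonoid R) (c : Ideal R)
    [h : IsArtinian R (c • (⊤ : Submodule R L) : Submodule R L)] :
    IsArtinian (Localization S) (c.map (algebraMap R (Localization S)) •
      (⊤ : Submodule (Localization S) (LocalizedModule S L)) :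
        Submodule (Localization S) (LocalizedModule S L)) := by
  let A := c.map (algebraMap R (Localization S)) •
      (⊤ : Submodule (Localization S) (LocalizedModule S L))
  -- contracting submodules of `S⁻¹ (c L)` to `c L` is strictly monotone
  let Φ : Submodule (Localization S) A → Submodule R (c • (⊤ : Submodule R L) : Submodule R L) :=
    fun W => ((W.map A.subtype).restrictScalars R).comap
      (LocalizedModule.mkLinearMap S L ∘ₗ Submodule.subtype _)
  have hle (W W' : Submodule (Localization S) A) (hW : Φ W ≤ Φ W') : W ≤ W' := by
    rintro ⟨w, hw⟩ hwW
    obtain ⟨x, hx, s, rfl⟩ := exists_mk_of_mem_map_smul_top S c hw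
    have hs : LocalizedModule.mk x 1 =
        algebraMap R (Localization S) s • LocalizedModule.mk x s := by
      rw [algebraMap_smul, LocalizedModule.smul'_mk]
      exact (LocalizedModule.mk_cancel s x).symm
    have h1 : (⟨x, hx⟩ : (c • (⊤ : Submodule R L) : Submodule R L)) ∈ Φ W :=
      ⟨algebraMap R (Localization S) s • ⟨_, hw⟩, W.smul_mem _ hwW, hs.symm⟩
    obtain ⟨y, hy, hyx⟩ := hW h1
    have h2 : Localization.mk 1 s • y = ⟨_, hw⟩ := by
      refine Subtype.ext ?_
      change Localization.mk 1 s • A.subtype y = _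
      rw [hyx]
      change Localization.mk 1 s • LocalizedModule.mk x 1 = _
      rw [LocalizedModule.mk_smul_mk, one_smul, mul_one]
    rw [← h2]
    exact W'.smul_mem _ hy
  have hmono : StrictMono Φ := fun W W' hlt =>
    ⟨Submodule.comap_mono (Submodule.map_mono hlt.le), fun h' => hlt.not_ge (hle _ _ h')⟩
  exact hmono.wellFoundedLT

/-- If `x / 1` lies in an Artinian submodule of `L_m` and `ann x` is a prime contained in `m`,
then `ann x = m`. Otherwise some `y ∈ m` is not in `p = ann x`; the chain `yⁿ (R_m x)` is
stationary, so `v yⁿ (y r - s) ∈ p` for some `n`, `r` and some `s, v ∉ m`, which forces `s ∈ m`. -/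
lemma eq_of_isArtinian_localization {m p : Ideal R} [m.IsPrime] [p.IsPrime] (hpm : p ≤ m) {x : L}
    (hx : ∀ r : R, r • x = 0 ↔ r ∈ p)
    (A : Submodule (Localization.AtPrime m) (LocalizedModule m.primeCompl L))
    [IsArtinian (Localization.AtPrime m) A] (hxA : LocalizedModule.mk x 1 ∈ A) : p = m := by
  refine le_antisymm hpm fun y hy => by_contra fun hyp => ?_
  let B := Submodule.span (Localization.AtPrime m)
    {(LocalizedModule.mk x 1 : LocalizedModule m.primeCompl L)}
  have : IsArtinian (Localization.AtPrime m) B :=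
    isArtinian_of_le ((Submodule.span_singleton_le_iff_mem _ _).2 hxA)
  obtain ⟨n, ⟨z, hz⟩, hzn⟩ := IsArtinian.exists_pow_succ_smul_dvd
    (algebraMap R (Localization.AtPrime m) y)
    (⟨LocalizedModule.mk x 1, Submodule.mem_span_singleton_self _⟩ : B)
  obtain ⟨q, rfl⟩ := Submodule.mem_span_singleton.1 hz
  induction q using Localization.induction_on with
  | H q =>
  obtain ⟨r, s⟩ := q
  have h1 : algebraMap R (Localization.AtPrime m) y ^ (n + 1) •
      Localization.mk r s • LocalizedModule.mk x 1 =
      algebraMap R (Localization.AtPrime m) y ^ n • LocalizedModule.mk x 1 :=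
    congr_arg Subtype.val hzn
  rw [← map_pow, ← map_pow, algebraMap_smul, algebraMap_smul, LocalizedModule.mk_smul_mk,
    LocalizedModule.smul'_mk, LocalizedModule.smul'_mk, LocalizedModule.mk_eq] at h1
  obtain ⟨v, hv⟩ := h1
  have h2 : (v : R) * (y ^ n * (y * r - s)) ∈ p := by
    rw [← hx]
    simp only [Submonoid.smul_def, smul_smul, OneMemClass.coe_one, one_mul, mul_one] at hv
    rw [← sub_eq_zero, ← sub_smul] at hv
    rw [← hv]
    congr 1
    ring
  have h3 := (‹p.IsPrime›.mem_or_mem h2).resolve_left fun h => v.2 (hpm h)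
  have h4 := (‹p.IsPrime›.mem_or_mem h3).resolve_left fun h =>
    hyp (‹p.IsPrime›.mem_of_pow_mem n h)
  refine s.2 ?_
  have h5 := m.sub_mem (m.mul_mem_right r hy) (hpm h4)
  rwa [sub_sub_cancel] at h5

/-- Let `L` be an `a`-torsion module with `(0 :_L a)` finitely generated. If at each maximal ideal
`m` some `b ^ t L_m` is Artinian, then some `b ^ t L` is Artinian. The associated primes of `L` are
those of `(0 :_L a)`, finitely many; a nonmaximal one is not associated to `b ^ t L` once
`b ^ t L_m` is Artinian for a maximal ideal `m` above it. So for large `t` all associated primes of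
`b ^ t L` are maximal, `(0 :_{b ^ t L} a)` is Artinian, and Melkersson's criterion applies. -/
theorem exists_isArtinian_of_localization [IsNoetherianRing R] {a b : Ideal R}
    (hL : IsPowerTorsion a L) [Module.Finite R (Submodule.torsionBySet R L (a : Set R))]
    (hloc : ∀ (m : Ideal R) [m.IsMaximal], ∃ t : ℕ, IsArtinian (Localization.AtPrime m)
      ((b.map (algebraMap R (Localization.AtPrime m))) ^ t •
        (⊤ : Submodule (Localization.AtPrime m) (LocalizedModule m.primeCompl L)) :
        Submodule (Localization.AtPrime m) (LocalizedModule m.primeCompl L))) :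
    ∃ t : ℕ, IsArtinian R (b ^ t • (⊤ : Submodule R L) : Submodule R L) := by
  have hfin : (associatedPrimes R L).Finite := by
    refine (associatedPrimes.finite R (Submodule.torsionBySet R L (a : Set R))).subset ?_
    intro p hp
    obtain ⟨hp, x, hx⟩ := isAssociatedPrime_iff.1 hp
    have hpx (r : R) : r ∈ p ↔ r • x = 0 := by
      rw [hx, Submodule.mem_colon_singleton, Submodule.mem_bot]
    obtain ⟨n, hn⟩ := hL x
    have hap : a ≤ p := hp.le_of_pow_le fun r hr => (hpx r).2 (hn r hr)
    refine isAssociatedPrime_iff.2 ⟨hp, ⟨x, (Submodule.mem_torsionBySet_iff _ _).2 fun r =>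
      (hpx r).1 (hap r.2)⟩, ?_⟩
    ext r
    rw [hpx, Submodule.mem_colon_singleton, Submodule.mem_bot, Subtype.ext_iff]
    rfl
  have hbad (p : Ideal R) (hp : p ∈ associatedPrimes R L) : ∃ t : ℕ, ∀ t', t ≤ t' →
      p ∈ associatedPrimes R (b ^ t' • (⊤ : Submodule R L) : Submodule R L) → p.IsMaximal := by
    obtain ⟨m, hm, hpm⟩ := p.exists_le_maximal hp.1.ne_top
    obtain ⟨t, ht⟩ := hloc m
    refine ⟨t, fun t' htt' hp' => ?_⟩
    have := hp.1
    obtain ⟨-, ⟨x, hxt⟩, hx⟩ := isAssociatedPrime_iff.1 hp'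
    have hpx (r : R) : r • x = 0 ↔ r ∈ p := by
      rw [hx, Submodule.mem_colon_singleton, Submodule.mem_bot, Subtype.ext_iff]
      rfl
    have hmem := mk_mem_map_smul_top m.primeCompl (b ^ t)
      (Submodule.smul_mono_left (Ideal.pow_le_pow_right htt') hxt) 1
    rw [Ideal.map_pow] at hmem
    rwa [eq_of_isArtinian_localization hpm hpx _ hmem]
  -- a single exponent serves all of the finitely many associated primes
  choose! e he using hbad
  let t := hfin.toFinset.sup e
  refine ⟨t, ?_⟩
  let X : Submodule R L := b ^ t • (⊤ : Submodule R L)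
  have hXL : associatedPrimes R X ⊆ associatedPrimes R L :=
    associatedPrimes.subset_of_injective X.subtype_injective
  have hX (p : Ideal R) (hp : p ∈ associatedPrimes R X) : p.IsMaximal :=
    he p (hXL hp) t (Finset.le_sup (f := e) (hfin.mem_toFinset.2 (hXL hp))) hp
  have hXt : IsPowerTorsion a X := hL.of_injective X.subtype X.subtype_injective
  let N := Submodule.torsionBySet R X (a : Set R)
  have : Module.Finite R N := by
    refine Module.Finite.of_injective (LinearMap.codRestrict
      (Submodule.torsionBySet R L (a : Set R)) (X.subtype ∘ₗ N.subtype) fun z => ?_)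
      fun z w h => ?_
    · rw [Submodule.mem_torsionBySet_iff]
      exact fun r => congr_arg Subtype.val ((Submodule.mem_torsionBySet_iff _ _).1 z.2 r)
    · have h' := congr_arg Subtype.val h
      exact Subtype.ext (Subtype.ext h')
  have : IsArtinian R N := isArtinian_of_associatedPrimes_isMaximal fun p hp =>
    hX p (associatedPrimes.subset_of_injective N.subtype_injective hp)
  exact hXt.isArtinian (IsNoetherian.noetherian a)

end LocalGlobal

/-! ### The minimaxness dimension -/

lemma lt_minimaxnessDimension_iff {R : Type u} [CommRing R] (b a : Ideal R) (M : Type u)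
    [AddCommGroup M] [Module R M] (r : ℕ) :
    (r : ℕ∞) < minimaxnessDimension b a M ↔ ∀ i : ℕ, 1 ≤ i → i ≤ r → ∃ t : ℕ, 1 ≤ t ∧
      IsMinimax R (b ^ t • (⊤ : Submodule R (LocalCoh a i M)) : Submodule R (LocalCoh a i M)) := by
  constructor
  · intro h i hi hir
    by_contra! hcon
    refine absurd (h.trans_le (sInf_le ⟨i, rfl, hi, hcon⟩)) (not_lt.2 (by exact_mod_cast hir))
  · intro h
    have h1 : ((r + 1 : ℕ) : ℕ∞) ≤ minimaxnessDimension b a M := by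
      refine le_sInf ?_
      rintro _ ⟨i, rfl, hi, hcon⟩
      by_contra! hlt
      have hir : i < r + 1 := by exact_mod_cast hlt
      obtain ⟨t, ht, htm⟩ := h i hi (by omega)
      exact hcon t ht htm
    exact lt_of_lt_of_le (by exact_mod_cast r.lt_succ_self) h1

theorem theorem2p6 {R : Type u} [CommRing R] [IsNoetherianRing R] (a b : Ideal R) (hba : b ≤ a)
    (M : Type u) [AddCommGroup M] [Module R M] [Module.Finite R M]
    (r : ℕ) (hr : 1 ≤ r)
    (hcof : ∀ i : ℕ, i < r → IsCofiniteModule a (LocalCoh a i M)) :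
    (∀ (p : Ideal R) [p.IsPrime],
      (r : ℕ∞) < minimaxnessDimension
        (b.map (algebraMap R (Localization.AtPrime p)))
        (a.map (algebraMap R (Localization.AtPrime p)))
        (LocalizedModule p.primeCompl M)) ↔
    (r : ℕ∞) < minimaxnessDimension b a M := by
  simp only [lt_minimaxnessDimension_iff]
  have hb : b.FG := IsNoetherian.noetherian b
  have hglob (i : ℕ) := exists_isMinimax_pow_smul_iff hb hba (localCohomology.isPowerTorsion a i M)
  have hloc (p : Ideal R) [p.IsPrime] (i : ℕ) :=
    exists_isMinimax_pow_smul_iff (hb.map (algebraMap R (Localization.AtPrime p)))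
      (Ideal.map_mono hba) (localCohomology.isPowerTorsion
        (a.map (algebraMap R (Localization.AtPrime p))) i (LocalizedModule p.primeCompl M))
  simp only [hglob, hloc]
  -- both sides now say that, for `1 ≤ i ≤ r`, some multiple `b ^ t H^i` is Artinian
  constructor
  · intro h i hi hir
    have hfin : Module.Finite R
        (Submodule.torsionBySet R (LocalCoh a i M) (a : Set R)) := by
      refine ExtFinite.finite_torsionBySet a ?_
      rcases hir.lt_or_eq with hir | rfl
      · exact (hcof i hir).2 0
      -- in degree `i = r`, which cofiniteness does not cover, only `Hom(R/a, -)` is finite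
      · obtain ⟨i, rfl⟩ := Nat.exists_eq_add_of_le' hi
        refine extFinite_zero_localCohomology a i M inferInstance (fun j => ?_)
          fun k hk j => (hcof (k + 1) (by omega)).2 (j + 1)
        exact ExtFinite.congr (localCohomology.zeroEquiv a M) ((hcof 0 (by omega)).2 (j + 1))
    refine exists_isArtinian_of_localization (localCohomology.isPowerTorsion a i M) fun m _ => ?_
    obtain ⟨t, ht⟩ := h m i hi hir
    obtain ⟨e⟩ := localCohomology.nonempty_localizationEquiv m.primeCompl a M i
    exact ⟨t, isArtinian_pow_smul_top_congr e.symm _⟩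
  · intro h p _ i hi hir
    obtain ⟨t, ht⟩ := h i hi hir
    obtain ⟨e⟩ := localCohomology.nonempty_localizationEquiv p.primeCompl a M i
    have := isArtinian_map_smul_top (L := LocalCoh a i M) p.primeCompl (b ^ t)
    rw [Ideal.map_pow] at this
    exact ⟨t, isArtinian_pow_smul_top_congr e _⟩
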